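/- Let $n\ge 2$ and let $\Sigma\subset\mathbb{R}^{n+1}$ be a (possibly immersed) $C^3$ hypersurface with unit normal field $\nu$ which is strictly convex, i.e. its second fundamental form $\langle\overline\nabla_Z\nu,Z\rangle$ is definite at every point ($\overline\nabla$ is the flat connection of $\mathbb{R}^{n+1}$). Let $r_1,\dots,r_n:\Sigma\to\mathbb{R}$ be its radii of curvature, i.e. at each point $q$ the numbers $r_k(q)$ are the solutions of $r\,\overline\nabla_Z\nu=Z$ with $0\neq Z\in T_q\Sigma$, and suppose that all of them have multiplicity $1$, i.e. $r_k(q)\ne r_l(q)$ for all $q$ and all $k\neq l$. Fix two distinct indices $i,j$ and suppose that for $k\in\{i,j\}$ the focal map $\mathcal{Y}_k:\Sigma\to\mathbb{R}^{n+1}$, $\mathcal{Y}_k(q)=q-r_k(q)\nu(q)$, is a $C^1$ diffeomorphism onto its image, the focal sheet $S_k=\mathcal{Y}_k(\Sigma)$ (an immersed submanifold). Let $X_i,X_j$ be vector fields on $\Sigma$ with $$r_k\overline\nabla_{X_k}\nu=X_k\quad\text{and}\quad \mathrm{d}r_k(X_k)=1\qquad(k=i,j).$$ Then $S_i$ is a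 hypersurface of class $C^2$, the vectors $\mathrm{d}\mathcal{Y}_i(X_i)$ and $\mathrm{d}\mathcal{Y}_i(X_j)$ are everywhere linearly independent, and, at every $q\in\Sigma$, the sectional curvature $K_i$ of $S_i$ with its induced Riemannian metric, at the point $\mathcal{Y}_i(q)$ and on the plane spanned by these two vectors, satisfies $$K_i\big(\mathrm{d}\mathcal{Y}_i(X_i),\mathrm{d}\mathcal{Y}_i(X_j)\big)=\frac{\mathrm{d}s_{ij}(X_i)-1}{s_{ij}^2},\qquad s_{ij}:=r_i-r_j.$$ Here, since the induced metric of a $C^2$ hypersurface is in general only of class $C^1$ in its charts, the derivatives of the Christoffel symbols in the Riemann curvature tensor are taken in the weak sense; the resulting tensor is continuous, and it is the classical one whenever the metric is of class $C^2$. -/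

import Mathlib

open scoped Manifold ContDiff

noncomputable section

namespace FocalSheet

/-- The coordinate space of an `n`-dimensional hypersurface. -/
abbrev Coord (n : ℕ) : Type := EuclideanSpace ℝ (Fin n)

/-- The ambient Euclidean space `ℝⁿ⁺¹`. -/
abbrev Ambient (n : ℕ) : Type := EuclideanSpace ℝ (Fin (n + 1))

/-! ### Sectional curvature of a hypersurface of class `C²`

A hypersurface of class `C²` has an induced metric which, in its charts, is only of class `C¹`.
Its Christoffel symbols are continuous, and the derivatives of the Christoffel symbols that enter
the Riemann tensor are taken in the weak sense. When the metric is of class `C²`, integration by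
parts shows that this is the classical Riemann tensor. -/

/-- The `i`-th partial derivative. -/
def pd {n : ℕ} (i : Fin n) (h : Coord n → ℝ) (x : Coord n) : ℝ :=
  fderiv ℝ h x (EuclideanSpace.single i 1)

/-- The metric `g_{ij} = ⟨∂_i φ, ∂_j φ⟩` induced by a parametrisation `φ`. -/
def inducedMetric {n : ℕ} (φ : Coord n → Ambient n) (x : Coord n) :
    Matrix (Fin n) (Fin n) ℝ :=
  Matrix.of fun i j =>
    inner ℝ (fderiv ℝ φ x (EuclideanSpace.single i 1)) (fderiv ℝ φ x (EuclideanSpace.single j 1))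

/-- Christoffel symbols of the first kind,
`Γ_{ij,k} = ⟨∇_{∂_i} ∂_j, ∂_k⟩ = (∂_i g_{jk} + ∂_j g_{ik} - ∂_k g_{ij}) / 2`. -/
def christoffel {n : ℕ} (g : Coord n → Matrix (Fin n) (Fin n) ℝ) (i j k : Fin n)
    (x : Coord n) : ℝ :=
  (pd i (fun y => g y j k) x + pd j (fun y => g y i k) x - pd k (fun y => g y i j) x) / 2

/-- The part of the Riemann tensor that is quadratic in the Christoffel symbols,
`g^{pq} (Γ_{ik,p} Γ_{jl,q} - Γ_{jk,p} Γ_{il,q})`. -/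
def quadraticPart {n : ℕ} (g : Coord n → Matrix (Fin n) (Fin n) ℝ) (i j k l : Fin n)
    (x : Coord n) : ℝ :=
  ∑ p, ∑ q, (g x)⁻¹ p q *
    (christoffel g i k p x * christoffel g j l q x -
      christoffel g j k p x * christoffel g i l q x)

/-- `R` is the Riemann curvature tensor of the metric `g` on the open set `U`, with the conventions
`R_{ijkl} = ⟨R(∂_i, ∂_j) ∂_k, ∂_l⟩` and `R(X, Y) = ∇_X ∇_Y - ∇_Y ∇_X - ∇_{[X, Y]}`: it is
continuous on `U` and
`R_{ijkl} = ∂_i Γ_{jk,l} - ∂_j Γ_{ik,l} + g^{pq} (Γ_{ik,p} Γ_{jl,q} - Γ_{jk,p} Γ_{il,q})`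
holds weakly on `U`. -/
structure IsRiemannTensorOn {n : ℕ} (U : Set (Coord n))
    (g : Coord n → Matrix (Fin n) (Fin n) ℝ)
    (R : Fin n → Fin n → Fin n → Fin n → Coord n → ℝ) : Prop where
  continuousOn : ∀ i j k l, ContinuousOn (R i j k l) U
  weak_eq : ∀ i j k l, ∀ η : Coord n → ℝ, ContDiff ℝ ∞ η → HasCompactSupport η → tsupport η ⊆ U →
    ∫ x, R i j k l x * η x =
      ∫ x, (christoffel g i k l x * pd j η x - christoffel g j k l x * pd i η x +
        quadraticPart g i j k l x * η x)

section Manifold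

variable {n : ℕ} {M : Type*} [TopologicalSpace M]

/-- `ψ`, followed by `f`, is a local parametrisation of class `C²` of the (immersed) hypersurface
`f(M)`: the map `f ∘ ψ` is a `C²` immersion on the open set `ψ.source`. Here `M` only
enumerates the points of the hypersurface and carries its topology. -/
structure IsC2Parametrisation (f : M → Ambient n)
    (ψ : OpenPartialHomeomorph (Coord n) M) : Prop where
  contDiffOn : ContDiffOn ℝ 2 (f ∘ ψ) ψ.source
  injective_fderiv : ∀ x ∈ ψ.source, Function.Injective (fderiv ℝ (f ∘ ψ) x)

/-- The immersed hypersurface `f(M)` is of class `C²` near its point `f q`, the vectors `u, w` are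
linearly independent tangent vectors to it at that point, and `K` is the sectional curvature
`⟨R(u, w) w, u⟩ / (|u|² |w|² - ⟨u, w⟩²)` of the plane spanned by `u` and `w`, for the
Riemannian metric induced from the ambient space. -/
def HasSectionalCurvatureAt (f : M → Ambient n) (q : M) (u w : Ambient n) (K : ℝ) : Prop :=
  LinearIndependent ℝ ![u, w] ∧
  (∃ ψ : OpenPartialHomeomorph (Coord n) M, IsC2Parametrisation f ψ ∧ q ∈ ψ.target) ∧
  ∀ ψ : OpenPartialHomeomorph (Coord n) M, IsC2Parametrisation f ψ → q ∈ ψ.target →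
    ∃ R : Fin n → Fin n → Fin n → Fin n → Coord n → ℝ,
      IsRiemannTensorOn ψ.source (inducedMetric (f ∘ ψ)) R ∧
      ∃ a b : Coord n,
        fderiv ℝ (f ∘ ψ) (ψ.symm q) a = u ∧ fderiv ℝ (f ∘ ψ) (ψ.symm q) b = w ∧
        K = (∑ i, ∑ j, ∑ k, ∑ l, R i j k l (ψ.symm q) * a i * b j * b k * a l) /
          (inner ℝ u u * inner ℝ w w - inner ℝ u w ^ 2)

/-! ### Hypersurfaces, radii of curvature, focal sheets -/

variable [ChartedSpace (Coord n) M]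

/-- The differential at `q` of a map from `M` to a vector space. For a field `ν` along the
hypersurface this is `X ↦ ∇̄_X ν`, the flat connection of the ambient space. -/
def diff {F : Type*} [NormedAddCommGroup F] [NormedSpace ℝ F] (f : M → F) (q : M) :
    TangentSpace (𝓡 n) q →L[ℝ] F :=
  mfderiv (𝓡 n) 𝓘(ℝ, F) f q

/-- `ι : M → ℝⁿ⁺¹` is an immersed hypersurface of class `C³`. -/
structure IsC3Hypersurface (ι : M → Ambient n) : Prop where
  contMDiff : ContMDiff (𝓡 n) 𝓘(ℝ, Ambient n) 3 ι
  injective_diff : ∀ q, Function.Injective (diff (n := n) ι q)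

/-- `ν` is a unit normal field along the hypersurface `ι`. -/
structure IsUnitNormal (ι ν : M → Ambient n) : Prop where
  contMDiff : ContMDiff (𝓡 n) 𝓘(ℝ, Ambient n) 2 ν
  norm_eq_one : ∀ q, ‖ν q‖ = 1
  orthogonal : ∀ q, ∀ Z : TangentSpace (𝓡 n) q, inner ℝ (ν q) (diff ι q Z) = 0

/-- Strict convexity: the second fundamental form `⟨∇̄_Z ν, Z⟩` is definite at every point. -/
def IsStrictlyConvex (ι ν : M → Ambient n) : Prop :=
  ∀ q, (∀ Z : TangentSpace (𝓡 n) q, Z ≠ 0 → 0 < inner ℝ (diff ν q Z) (diff ι q Z)) ∨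
    (∀ Z : TangentSpace (𝓡 n) q, Z ≠ 0 → inner ℝ (diff ν q Z) (diff ι q Z) < 0)

/-- `(r_i)` are the radii of curvature of the hypersurface, and all of them have multiplicity
`1`: at each point they are `n` distinct solutions of `r ∇̄_Z ν = Z`, `Z ≠ 0`. -/
structure AreSimpleRadii (ι ν : M → Ambient n) (r : Fin n → M → ℝ) : Prop where
  eigen : ∀ i q, ∃ Z : TangentSpace (𝓡 n) q, Z ≠ 0 ∧ r i q • diff ν q Z = diff ι q Z
  simple : ∀ q, Function.Injective fun i => r i q

/-- The focal map `q ↦ q - r(q) ν(q)`. -/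
def focalMap (ι ν : M → Ambient n) (r : M → ℝ) (q : M) : Ambient n :=
  ι q - r q • ν q

/-- `f` is a diffeomorphism of `M` onto its image, an immersed submanifold: an injective
immersion of class `C¹`. -/
structure IsDiffeoOntoImage (f : M → Ambient n) : Prop where
  contMDiff : ContMDiff (𝓡 n) 𝓘(ℝ, Ambient n) 1 f
  injective : Function.Injective f
  injective_diff : ∀ q, Function.Injective (diff (n := n) f q)

/-- The field `X` satisfies `r ∇̄_X ν = X` and `dr(X) = 1`. -/
structure IsNormalisedPrincipalField (ι ν : M → Ambient n) (r : M → ℝ)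
    (X : (q : M) → TangentSpace (𝓡 n) q) : Prop where
  principal : ∀ q, r q • diff ν q (X q) = diff ι q (X q)
  normalised : ∀ q, diff r q (X q) = 1

end Manifold

end FocalSheet

end

/-! ### Antisymmetrised integration by parts for `C¹` functions -/

open MeasureTheory Filter Topology

/-! Write `D = dι`, `B = dν` and `f = ι - r_i ν`. Then `df(w) = D w - r_i B w - dr_i(w) ν`, and
pairing with `D X_i` gives zero because the second fundamental form is symmetric and `r_i B X_i = D
X_i`. So the principal direction `N = D X_i` is normal to the focal sheet, and everything is read
off from it.

Regularity: `r_k = ⟨ν, ι - Y_k⟩` is `C¹`, and a simple eigendirection of `C¹` data is `C¹` after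
rescaling (`exists_principal_field`). Thus `f` is a `C¹` immersion with a `C¹` normal, which becomes
`C²` in the parameters given by projection to a tangent space
(`exists_contDiffOn_two_reparametrisation`).

Curvature: formally, the third derivatives of a parametrisation cancel in the Riemann tensor.
Weakly, this is `∫ ∂_v a ∂_w b = ∫ ∂_w a ∂_v b` for `C¹` functions. Products of second derivatives
remain, the quadratic Christoffel terms remove their tangential parts, and the Gauss equation
results (`sum_riemannTensor`), with second fundamental form `-⟨dN, df⟩`.

Finally `df(X_i) = -ν` and `df(X_j) = (1 - r_i/r_j) D X_j - dr_i(X_j) ν`. The mixed entry `⟨dN(X_j),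
ν⟩` vanishes since principal directions are orthogonal, `⟨dN(X_i), ν⟩ = -|D X_i|²/r_i`, and the
Codazzi equation expresses `⟨dN(X_j), D X_j⟩` through `dr_j(X_i)`. The quotient is `-dr_j(X_i)/(r_i
- r_j)²`, which is the claim because `dr_i(X_i) = 1` (`focal_curvature`). -/

theorem integral_fderiv_mul_fderiv_comm {E : Type*} [NormedAddCommGroup E] [NormedSpace ℝ E]
    [FiniteDimensional ℝ E] [MeasurableSpace E] [BorelSpace E] (μ : Measure E)
    [μ.IsAddHaarMeasure] {a b : E → ℝ} (ha : ContDiff ℝ 1 a) (hac : HasCompactSupport a)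
    (hb : ContDiff ℝ 1 b) (hbc : HasCompactSupport b) (v w : E) :
    ∫ x, fderiv ℝ a x v * fderiv ℝ b x w ∂μ = ∫ x, fderiv ℝ a x w * fderiv ℝ b x v ∂μ := by
  obtain ⟨A, hA⟩ := ha.lipschitzWith_of_hasCompactSupport hac one_ne_zero
  obtain ⟨B, hB⟩ := hb.lipschitzWith_of_hasCompactSupport hbc one_ne_zero
  have hda : ∀ x, DifferentiableAt ℝ a x := fun x => ha.differentiable one_ne_zero x
  have hdb : ∀ x, DifferentiableAt ℝ b x := fun x => hb.differentiable one_ne_zero x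
  have ca : Continuous fun x => fderiv ℝ a x v :=
    (ha.continuous_fderiv one_ne_zero).clm_apply continuous_const
  have cb : Continuous fun x => fderiv ℝ b x v :=
    (hb.continuous_fderiv one_ne_zero).clm_apply continuous_const
  have ia : Integrable (fun x => fderiv ℝ a x v) μ :=
    ca.integrable_of_hasCompactSupport (hac.fderiv_apply ℝ v)
  have ib : Integrable (fun x => fderiv ℝ b x v) μ :=
    cb.integrable_of_hasCompactSupport (hbc.fderiv_apply ℝ v)
  have T₁ := hB.integral_inv_smul_sub_mul_tendsto_integral_lineDeriv_mul (μ := μ) ia w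
  have T₂ := (hA.integral_inv_smul_sub_mul_tendsto_integral_lineDeriv_mul (μ := μ) ib (-w)).neg
  -- `b` has no second derivatives, so `∂_w b` is replaced by a difference quotient. Integration by
  -- parts in `v` and a translation by `t • w` move the quotient onto `a`, in direction `-w`; then
  -- `t → 0` on both sides.
  have key : ∀ t : ℝ, ∫ x, (t⁻¹ • (b (x + t • w) - b x)) * fderiv ℝ a x v ∂μ =
      -∫ x, (t⁻¹ • (a (x + t • (-w)) - a x)) * fderiv ℝ b x v ∂μ := by
    intro t
    have hc : ContDiff ℝ 1 fun x => t⁻¹ • (b (x + t • w) - b x) := by fun_prop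
    have hcc : HasCompactSupport fun x => t⁻¹ • (b (x + t • w) - b x) := by
      have h1 : HasCompactSupport fun x => b (x + t • w) :=
        hbc.comp_homeomorph (Homeomorph.addRight (t • w))
      exact (h1.sub hbc).smul_left (f := fun _ => t⁻¹)
    obtain ⟨C, hC⟩ := hc.lipschitzWith_of_hasCompactSupport hcc one_ne_zero
    have e := hA.integral_lineDeriv_mul_eq (μ := μ) hC hcc v
    have e1 : ∀ x, lineDeriv ℝ (fun x => t⁻¹ • (b (x + t • w) - b x)) x (-v) =
        -(t⁻¹ * (fderiv ℝ b (x + t • w) v - fderiv ℝ b x v)) := by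
      intro x
      have hx : HasFDerivAt (fun x => t⁻¹ • (b (x + t • w) - b x))
          (t⁻¹ • (fderiv ℝ b (x + t • w) - fderiv ℝ b x)) x := by
        have h1 : HasFDerivAt (fun x => b (x + t • w)) (fderiv ℝ b (x + t • w)) x := by
          have := (hdb (x + t • w)).hasFDerivAt.comp x ((hasFDerivAt_id x).add_const (t • w))
          exact this
        exact (h1.fun_sub (hdb x).hasFDerivAt).fun_const_smul _
      rw [hx.differentiableAt.lineDeriv_eq_fderiv, hx.fderiv]
      simp
      ring
    simp_rw [e1, fun x => (hda x).lineDeriv_eq_fderiv (v := v)] at e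
    have e2 : ∫ x, fderiv ℝ b (x + t • w) v * a x ∂μ =
        ∫ x, fderiv ℝ b x v * a (x + t • (-w)) ∂μ := by
      rw [← integral_add_right_eq_self (μ := μ)
        (fun x => fderiv ℝ b x v * a (x + t • (-w))) (t • w)]
      simp
    have i1 : Integrable (fun x => fderiv ℝ b (x + t • w) v * a x) μ := by
      have hcon : Continuous fun x => fderiv ℝ b (x + t • w) v * a x :=
        (cb.comp (continuous_id.add continuous_const)).mul ha.continuous
      exact hcon.integrable_of_hasCompactSupport
        (hac.mul_left (f := fun x => fderiv ℝ b (x + t • w) v))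
    have i2 : Integrable (fun x => fderiv ℝ b x v * a x) μ :=
      (cb.mul ha.continuous).integrable_of_hasCompactSupport
        (hac.mul_left (f := fun x => fderiv ℝ b x v))
    have i3 : Integrable (fun x => fderiv ℝ b x v * a (x + t • (-w))) μ := by
      have hcon : Continuous fun x => fderiv ℝ b x v * a (x + t • (-w)) :=
        cb.mul (ha.continuous.comp (continuous_id.add continuous_const))
      exact hcon.integrable_of_hasCompactSupport ((hbc.fderiv_apply ℝ v).mul_right)
    calc ∫ x, (t⁻¹ • (b (x + t • w) - b x)) * fderiv ℝ a x v ∂μ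
        = ∫ x, fderiv ℝ a x v * (t⁻¹ • (b (x + t • w) - b x)) ∂μ := by simp_rw [mul_comm]
      _ = ∫ x, -(t⁻¹ * (fderiv ℝ b (x + t • w) v - fderiv ℝ b x v)) * a x ∂μ := e
      _ = ∫ x, -t⁻¹ * (fderiv ℝ b (x + t • w) v * a x - fderiv ℝ b x v * a x) ∂μ := by
          congr 1; ext x; ring
      _ = -∫ x, t⁻¹ * (fderiv ℝ b x v * a (x + t • (-w)) - fderiv ℝ b x v * a x) ∂μ := by
          rw [integral_const_mul, integral_const_mul, integral_sub i1 i2, integral_sub i3 i2, e2]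
          ring
      _ = _ := by
          congr 2; ext x; simp only [smul_eq_mul]; ring
  simp_rw [key] at T₁
  have := tendsto_nhds_unique T₁ T₂
  simp_rw [fun x (u : E) => (hda x).lineDeriv_eq_fderiv (v := u),
    fun x (u : E) => (hdb x).lineDeriv_eq_fderiv (v := u)] at this
  simp only [map_neg, neg_mul, integral_neg, neg_neg] at this
  rw [← this]
  simp_rw [mul_comm]

/-- A function of class `C¹` on an open set can be modified away from a compact subset so as to
become a compactly supported function of class `C¹`. -/
theorem exists_contDiff_hasCompactSupport_eventuallyEq {E F : Type*} [NormedAddCommGroup E]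
    [NormedSpace ℝ E] [FiniteDimensional ℝ E] [NormedAddCommGroup F] [NormedSpace ℝ F]
    {a : E → F} {U K : Set E} (hU : IsOpen U) (ha : ContDiffOn ℝ 1 a U) (hK : IsCompact K)
    (hKU : K ⊆ U) :
    ∃ a' : E → F, ContDiff ℝ 1 a' ∧ HasCompactSupport a' ∧ ∀ x ∈ K, a' =ᶠ[𝓝 x] a := by
  obtain ⟨L, hL, hKL, hLU⟩ := exists_compact_between hK hU hKU
  obtain ⟨χ, hχ1, hχ0, -⟩ := exists_contMDiffMap_one_nhds_of_subset_interior (n := 1) 𝓘(ℝ, E)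
    hK.isClosed hKL
  have hχ : ContDiff ℝ 1 χ := χ.contMDiff.contDiff
  refine ⟨fun x => χ x • a x, contDiff_iff_contDiffAt.2 fun x => ?_, ?_, fun x hx => ?_⟩
  · by_cases hx : x ∈ U
    · exact hχ.contDiffAt.smul (ha.contDiffAt (hU.mem_nhds hx))
    · have : (fun x => χ x • a x) =ᶠ[𝓝 x] fun _ => 0 := by
        filter_upwards [hL.isClosed.isOpen_compl.mem_nhds fun h => hx (hLU h)] with y hy
        rw [hχ0 y hy, zero_smul]
      exact contDiffAt_const.congr_of_eventuallyEq this
  · refine HasCompactSupport.intro hL fun x hx => ?_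
    rw [hχ0 x hx, zero_smul]
  · filter_upwards [eventually_nhdsSet_iff_forall.1 hχ1 x hx] with y hy
    rw [hy, one_smul]

/-- Antisymmetrised integration by parts for vector-valued functions, one of which is only
defined near the support of the other. -/
theorem integral_inner_fderiv_comm {E : Type*} [NormedAddCommGroup E] [NormedSpace ℝ E]
    [FiniteDimensional ℝ E] [MeasurableSpace E] [BorelSpace E] (μ : Measure E)
    [μ.IsAddHaarMeasure] {m : ℕ} {a b : E → EuclideanSpace ℝ (Fin m)} {U : Set E} (hU : IsOpen U)
    (ha : ContDiffOn ℝ 1 a U)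
    (hb : ContDiff ℝ 1 b) (hbc : HasCompactSupport b) (hbU : tsupport b ⊆ U) (v w : E) :
    ∫ x, inner ℝ (fderiv ℝ a x v) (fderiv ℝ b x w) ∂μ =
      ∫ x, inner ℝ (fderiv ℝ a x w) (fderiv ℝ b x v) ∂μ := by
  obtain ⟨a', ha', hac', haa'⟩ :=
    exists_contDiff_hasCompactSupport_eventuallyEq hU ha hbc hbU
  have comp : ∀ {c : E → EuclideanSpace ℝ (Fin m)} (_ : ContDiff ℝ 1 c) (k : Fin m),
      ContDiff ℝ 1 fun x => c x k := fun hc k => (contDiff_piLp 2).1 hc k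
  have compd : ∀ {c : E → EuclideanSpace ℝ (Fin m)} (_ : ContDiff ℝ 1 c) (k : Fin m) (x u : E),
      fderiv ℝ (fun y => c y k) x u = fderiv ℝ c x u k := by
    intro c hc k x u
    have h := (PiLp.hasFDerivAt_apply (𝕜 := ℝ) 2 (E := fun _ : Fin m => ℝ) (c x) k).comp x
      (hc.differentiable one_ne_zero x).hasFDerivAt
    exact DFunLike.congr_fun h.fderiv u
  have comps : ∀ {c : E → EuclideanSpace ℝ (Fin m)} (_ : HasCompactSupport c) (k : Fin m),
      HasCompactSupport fun x => c x k := fun hc k =>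
    hc.comp_left (g := fun z : EuclideanSpace ℝ (Fin m) => z k) rfl
  have pt : ∀ u u' x, inner ℝ (fderiv ℝ a x u) (fderiv ℝ b x u') =
      ∑ k, fderiv ℝ (fun y => a' y k) x u * fderiv ℝ (fun y => b y k) x u' := by
    intro u u' x
    simp_rw [compd ha', compd hb]
    by_cases hx : x ∈ tsupport b
    · rw [(haa' x hx).fderiv_eq, PiLp.inner_apply]
      exact Finset.sum_congr rfl fun k _ => by simp [mul_comm]
    · have : fderiv ℝ b x = 0 := by
        by_contra h
        exact hx (support_fderiv_subset ℝ h)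
      simp [this]
  simp_rw [pt]
  have int : ∀ u u' (k : Fin m), Integrable
      (fun x => fderiv ℝ (fun y => a' y k) x u * fderiv ℝ (fun y => b y k) x u') μ := by
    intro u u' k
    refine Continuous.integrable_of_hasCompactSupport ?_
      (((comps hbc k).fderiv_apply ℝ u').mul_left)
    exact (((comp ha' k).continuous_fderiv one_ne_zero).clm_apply continuous_const).mul
      (((comp hb k).continuous_fderiv one_ne_zero).clm_apply continuous_const)
  rw [integral_finsetSum _ fun k _ => int _ _ k, integral_finsetSum _ fun k _ => int _ _ k]
  exact Finset.sum_congr rfl fun k _ => integral_fderiv_mul_fderiv_comm μ (comp ha' k)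
    (comps hac' k) (comp hb k) (comps hbc k) v w

/-! ### Normals and Gram matrices of an injective map of codimension one -/

section LinearAlgebra

variable {n : ℕ} {D : FocalSheet.Coord n →L[ℝ] FocalSheet.Ambient n} {N : FocalSheet.Ambient n}

theorem finrank_range_orthogonal (hD : Function.Injective D) :
    Module.finrank ℝ (LinearMap.range D.toLinearMap)ᗮ = 1 := by
  have h1 := Submodule.finrank_add_finrank_orthogonal (LinearMap.range D.toLinearMap)
  rw [LinearMap.finrank_range_of_inj hD] at h1
  simp only [finrank_euclideanSpace, Fintype.card_fin] at h1
  omega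

theorem exists_eq_smul_of_orthogonal_range (hD : Function.Injective D) (hN : N ≠ 0)
    (hND : ∀ z, inner ℝ N (D z) = 0) {v : FocalSheet.Ambient n} (hv : ∀ z, inner ℝ v (D z) = 0) :
    ∃ c : ℝ, v = c • N := by
  have mem : ∀ {y : FocalSheet.Ambient n}, (∀ z, inner ℝ y (D z) = 0) →
      y ∈ (LinearMap.range D.toLinearMap)ᗮ := by
    rintro y hy _ ⟨z, rfl⟩
    rw [real_inner_comm]
    exact hy z
  obtain ⟨c, hc⟩ := (finrank_eq_one_iff_of_nonzero' (⟨N, mem hND⟩ : (LinearMap.range D.toLinearMap)ᗮ)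
    (fun h => hN (congrArg Subtype.val h))).1 (finrank_range_orthogonal hD) ⟨v, mem hv⟩
  exact ⟨c, (congrArg Subtype.val hc).symm⟩

theorem eq_zero_of_orthogonal_range (hD : Function.Injective D) (hN : N ≠ 0)
    (hND : ∀ z, inner ℝ N (D z) = 0) {v : FocalSheet.Ambient n} (hv : ∀ z, inner ℝ v (D z) = 0)
    (hvN : inner ℝ N v = 0) : v = 0 := by
  obtain ⟨c, rfl⟩ := exists_eq_smul_of_orthogonal_range hD hN hND hv
  rw [inner_smul_right, mul_eq_zero, inner_self_eq_zero] at hvN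
  rw [hvN.resolve_right hN, zero_smul]

theorem exists_apply_eq_of_inner_eq_zero (hD : Function.Injective D) (hN : N ≠ 0)
    (hND : ∀ z, inner ℝ N (D z) = 0) {v : FocalSheet.Ambient n} (hvN : inner ℝ N v = 0) :
    ∃ x, D x = v := by
  suffices v ∈ LinearMap.range D.toLinearMap from this
  rw [← Submodule.orthogonal_orthogonal (LinearMap.range D.toLinearMap)]
  intro y hy
  obtain ⟨c, rfl⟩ := exists_eq_smul_of_orthogonal_range hD hN hND (v := y) fun z => by
    rw [real_inner_comm]
    exact hy _ ⟨z, rfl⟩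
  rw [inner_smul_left, hvN, mul_zero]

theorem exists_eq_add_smul (hD : Function.Injective D) (hN : N ≠ 0)
    (hND : ∀ z, inner ℝ N (D z) = 0) (v : FocalSheet.Ambient n) :
    ∃ x, v = D x + (inner ℝ v N / inner ℝ N N) • N := by
  have hNN : inner ℝ N N ≠ 0 := inner_self_ne_zero.2 hN
  obtain ⟨x, hx⟩ := exists_apply_eq_of_inner_eq_zero hD hN hND
    (v := v - (inner ℝ v N / inner ℝ N N) • N) (by
      rw [inner_sub_right, inner_smul_right, div_mul_cancel₀ _ hNN, real_inner_comm, sub_self])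
  exact ⟨x, by rw [hx, sub_add_cancel]⟩

theorem sum_smul_single (a : FocalSheet.Coord n) :
    ∑ i, a i • EuclideanSpace.single i (1 : ℝ) = a := by
  ext k
  simp [Pi.single_apply]

theorem gram_mulVec (D : FocalSheet.Coord n →L[ℝ] FocalSheet.Ambient n) (x : FocalSheet.Coord n)
    (p : Fin n) :
    (Matrix.of fun i j => inner ℝ (D (EuclideanSpace.single i 1))
      (D (EuclideanSpace.single j 1))).mulVec x p =
      inner ℝ (D (EuclideanSpace.single p 1)) (D x) := by
  conv_rhs => rw [← sum_smul_single x]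
  simp [Matrix.mulVec, dotProduct, inner_sum, inner_smul_right, mul_comm]

theorem isUnit_det_gram (hD : Function.Injective D) :
    IsUnit (Matrix.of fun i j => inner ℝ (D (EuclideanSpace.single i 1))
      (D (EuclideanSpace.single j 1)) : Matrix (Fin n) (Fin n) ℝ).det := by
  rw [← Matrix.isUnit_iff_isUnit_det, ← Matrix.mulVec_injective_iff_isUnit]
  rw [← Matrix.coe_mulVecLin, injective_iff_map_eq_zero]
  intro x hx
  have h0 : ∀ p, inner ℝ (D (EuclideanSpace.single p 1)) (D (WithLp.toLp 2 x)) = 0 := fun p => by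
    rw [← gram_mulVec]
    exact congrFun hx p
  have h1 : inner ℝ (D (WithLp.toLp 2 x)) (D (WithLp.toLp 2 x)) = (0 : ℝ) := by
    nth_rw 1 [← sum_smul_single (WithLp.toLp 2 x)]
    simp [sum_inner, inner_smul_left, h0]
  have h2 : WithLp.toLp 2 x = 0 := hD (by rw [inner_self_eq_zero.1 h1, map_zero])
  exact congrArg WithLp.ofLp h2

/-- The inner product of the tangential parts of two vectors in terms of the inverse Gram
matrix. -/
theorem sum_gram_inv_mul (hD : Function.Injective D) (hN : N ≠ 0)
    (hND : ∀ z, inner ℝ N (D z) = 0) (α β : FocalSheet.Ambient n) :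
    ∑ p, ∑ q, (Matrix.of fun i j => inner ℝ (D (EuclideanSpace.single i 1))
      (D (EuclideanSpace.single j 1)) : Matrix (Fin n) (Fin n) ℝ)⁻¹ p q *
        (inner ℝ α (D (EuclideanSpace.single p 1)) * inner ℝ β (D (EuclideanSpace.single q 1))) =
      inner ℝ α β - inner ℝ α N * inner ℝ β N / inner ℝ N N := by
  set g : Matrix (Fin n) (Fin n) ℝ := Matrix.of fun i j => inner ℝ (D (EuclideanSpace.single i 1))
      (D (EuclideanSpace.single j 1)) with hg
  obtain ⟨x, hx⟩ := exists_eq_add_smul hD hN hND β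
  -- Pairing `β` with the basis vectors sees only its tangential part `D x` and gives `g x`, so
  -- `g⁻¹` recovers the coordinates `x`.
  have hβ : (fun q => inner ℝ β (D (EuclideanSpace.single q 1))) = g.mulVec x := by
    ext q
    rw [hg, gram_mulVec, hx, inner_add_left, inner_smul_left, hND, mul_zero, add_zero,
      real_inner_comm]
  have h1 : g⁻¹.mulVec (g.mulVec x) = x := by
    rw [Matrix.mulVec_mulVec, Matrix.nonsing_inv_mul _ (isUnit_det_gram hD), Matrix.one_mulVec]
  have h2 : ∀ p, ∑ q, g⁻¹ p q * (inner ℝ α (D (EuclideanSpace.single p 1)) *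
      inner ℝ β (D (EuclideanSpace.single q 1))) =
      inner ℝ α (D (EuclideanSpace.single p 1)) * x p := by
    intro p
    rw [← congrFun h1 p, ← hβ]
    simp only [Matrix.mulVec, dotProduct, Finset.mul_sum]
    exact Finset.sum_congr rfl fun q _ => by ring
  simp_rw [h2]
  have h3 : inner ℝ α (D x) = ∑ p, inner ℝ α (D (EuclideanSpace.single p 1)) * x p := by
    conv_lhs => rw [← sum_smul_single x]
    simp [inner_sum, inner_smul_right, mul_comm]
  rw [← h3]
  have h4 : inner ℝ α β = inner ℝ α (D x) + inner ℝ β N / inner ℝ N N * inner ℝ α N := by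
    conv_lhs => rw [hx]
    rw [inner_add_right, inner_smul_right]
  rw [h4]
  ring

end LinearAlgebra

/-! ### The weak Riemann tensor and the Gauss equation -/

namespace FocalSheet

variable {n : ℕ} {φ : Coord n → Ambient n} {U : Set (Coord n)}

theorem pd_inducedMetric {x : Coord n} (hφ : ContDiffAt ℝ 2 φ x) (i j k : Fin n) :
    pd i (fun y => inducedMetric φ y j k) x =
      inner ℝ (fderiv ℝ (fderiv ℝ φ) x (EuclideanSpace.single i 1) (EuclideanSpace.single j 1))
        (fderiv ℝ φ x (EuclideanSpace.single k 1)) +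
      inner ℝ (fderiv ℝ φ x (EuclideanSpace.single j 1))
        (fderiv ℝ (fderiv ℝ φ) x (EuclideanSpace.single i 1) (EuclideanSpace.single k 1)) := by
  have hd : HasFDerivAt (fderiv ℝ φ) (fderiv ℝ (fderiv ℝ φ) x) x :=
    ((hφ.fderiv_right (m := 1) le_rfl).differentiableAt one_ne_zero).hasFDerivAt
  have h : ∀ v : Coord n, HasFDerivAt (fun y => fderiv ℝ φ y v)
      ((fderiv ℝ (fderiv ℝ φ) x).flip v) x := fun v => by
    simpa using hd.clm_apply (hasFDerivAt_const v x)
  unfold pd inducedMetric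
  simp only [Matrix.of_apply]
  rw [fderiv_inner_apply ℝ (h _).differentiableAt (h _).differentiableAt, (h _).fderiv,
    (h _).fderiv]
  simp [add_comm]

theorem christoffel_inducedMetric {x : Coord n} (hφ : ContDiffAt ℝ 2 φ x) (i j k : Fin n) :
    christoffel (inducedMetric φ) i j k x =
      inner ℝ (fderiv ℝ (fderiv ℝ φ) x (EuclideanSpace.single i 1) (EuclideanSpace.single j 1))
        (fderiv ℝ φ x (EuclideanSpace.single k 1)) := by
  have hs : ∀ v w, fderiv ℝ (fderiv ℝ φ) x v w = fderiv ℝ (fderiv ℝ φ) x w v :=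
    fun v w => hφ.isSymmSndFDerivAt (by simp) v w
  unfold christoffel
  rw [pd_inducedMetric hφ, pd_inducedMetric hφ, pd_inducedMetric hφ,
    hs (EuclideanSpace.single j 1) (EuclideanSpace.single i 1),
    hs (EuclideanSpace.single k 1) (EuclideanSpace.single i 1),
    hs (EuclideanSpace.single k 1) (EuclideanSpace.single j 1),
    real_inner_comm _ (fderiv ℝ φ x (EuclideanSpace.single i 1)),
    real_inner_comm _ (fderiv ℝ φ x (EuclideanSpace.single j 1))]
  ring

/-- The Riemann tensor of the metric induced by a parametrisation of class `C²`. -/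
noncomputable def riemannTensor (φ : Coord n → Ambient n) (i j k l : Fin n) (x : Coord n) : ℝ :=
  inner ℝ (fderiv ℝ (fderiv ℝ φ) x (EuclideanSpace.single j 1) (EuclideanSpace.single k 1))
      (fderiv ℝ (fderiv ℝ φ) x (EuclideanSpace.single i 1) (EuclideanSpace.single l 1)) -
    inner ℝ (fderiv ℝ (fderiv ℝ φ) x (EuclideanSpace.single i 1) (EuclideanSpace.single k 1))
      (fderiv ℝ (fderiv ℝ φ) x (EuclideanSpace.single j 1) (EuclideanSpace.single l 1)) +
    quadraticPart (inducedMetric φ) i j k l x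

/-- With `a = ∂_k φ` and `b = η ∂_l φ`, the term `Γ_{ik,l} ∂_j η` equals `⟨∂_i a, ∂_j b⟩ - η ⟨∂_i
∂_k φ, ∂_j ∂_l φ⟩`. After antisymmetrising in `i, j` the integrals of the first terms cancel, so
third derivatives never occur. -/
theorem isRiemannTensorOn_riemannTensor (hU : IsOpen U) (hφ : ContDiffOn ℝ 2 φ U)
    (hinj : ∀ x ∈ U, Function.Injective (fderiv ℝ φ x)) :
    IsRiemannTensorOn U (inducedMetric φ) (riemannTensor φ) := by
  have hat : ∀ x ∈ U, ContDiffAt ℝ 2 φ x := fun x hx => hφ.contDiffAt (hU.mem_nhds hx)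
  have hd1 : ContDiffOn ℝ 1 (fderiv ℝ φ) U := hφ.fderiv_of_isOpen hU le_rfl
  have hc1 : ∀ v, ContinuousOn (fun x => fderiv ℝ φ x v) U := fun v =>
    hd1.continuousOn.clm_apply continuousOn_const
  have hc2 : ∀ v w, ContinuousOn (fun x => fderiv ℝ (fderiv ℝ φ) x v w) U := fun v w =>
    ((hd1.continuousOn_fderiv_of_isOpen hU le_rfl).clm_apply
      continuousOn_const).clm_apply continuousOn_const
  have hg : ContinuousOn (inducedMetric φ) U :=
    continuousOn_pi.2 fun i => continuousOn_pi.2 fun j => (hc1 _).inner (hc1 _)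
  have hginv : ∀ p q, ContinuousOn (fun x => (inducedMetric φ x)⁻¹ p q) U := by
    intro p q
    have h1 : ContinuousOn (fun x => (inducedMetric φ x)⁻¹) U := by
      have hadj : ContinuousOn (fun x => (inducedMetric φ x).adjugate) U :=
        (continuous_id.matrix_adjugate).comp_continuousOn hg
      have hdet : ContinuousOn (fun x => (inducedMetric φ x).det) U :=
        (continuous_id.matrix_det).comp_continuousOn hg
      simp_rw [Matrix.inv_def, Ring.inverse_eq_inv']
      exact (hdet.inv₀ fun x hx => (isUnit_det_gram (hinj x hx)).ne_zero).smul hadj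
    exact continuousOn_pi.1 (continuousOn_pi.1 h1 p) q
  have hchr : ∀ i j k, ContinuousOn (christoffel (inducedMetric φ) i j k) U := fun i j k =>
    ((hc2 _ _).inner (hc1 _)).congr fun x hx => christoffel_inducedMetric (hat x hx) i j k
  have hquad : ∀ i j k l, ContinuousOn (quadraticPart (inducedMetric φ) i j k l) U := by
    intro i j k l
    unfold quadraticPart
    exact continuousOn_finsetSum _ fun p _ => continuousOn_finsetSum _ fun q _ =>
      (hginv p q).mul (((hchr _ _ _).mul (hchr _ _ _)).sub ((hchr _ _ _).mul (hchr _ _ _)))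
  refine ⟨fun i j k l => (((hc2 _ _).inner (hc2 _ _)).sub ((hc2 _ _).inner (hc2 _ _))).add
    (hquad i j k l), fun i j k l η hη hηc hηU => ?_⟩
  set ei : Coord n := EuclideanSpace.single i 1
  set ej : Coord n := EuclideanSpace.single j 1
  set ek : Coord n := EuclideanSpace.single k 1
  set el : Coord n := EuclideanSpace.single l 1
  have hη1 : ContDiff ℝ 1 η := hη.of_le (by norm_cast)
  have ha : ContDiffOn ℝ 1 (fun x => fderiv ℝ φ x ek) U := hd1.clm_apply contDiffOn_const
  have hb0 : ContDiffOn ℝ 1 (fun x => fderiv ℝ φ x el) U := hd1.clm_apply contDiffOn_const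
  have hbts : tsupport (fun x => η x • fderiv ℝ φ x el) ⊆ tsupport η :=
    tsupport_smul_subset_left η _
  have hb : ContDiff ℝ 1 (fun x => η x • fderiv ℝ φ x el) := by
    refine contDiff_iff_contDiffAt.2 fun x => ?_
    by_cases hx : x ∈ tsupport η
    · exact hη1.contDiffAt.smul (hb0.contDiffAt (hU.mem_nhds (hηU hx)))
    · have : (fun x => η x • fderiv ℝ φ x el) =ᶠ[𝓝 x] fun _ => 0 := by
        filter_upwards [(isClosed_tsupport η).isOpen_compl.mem_nhds hx] with y hy
        rw [image_eq_zero_of_notMem_tsupport hy, zero_smul]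
      exact contDiffAt_const.congr_of_eventuallyEq this
  have hbc : HasCompactSupport (fun x => η x • fderiv ℝ φ x el) := hηc.smul_right
  have main := integral_inner_fderiv_comm volume hU ha hb hbc (hbts.trans hηU) ei ej
  have hder : ∀ x ∈ U, ∀ m v : Coord n, HasFDerivAt (fun y => fderiv ℝ φ y m)
      ((fderiv ℝ (fderiv ℝ φ) x).flip m) x := fun x hx m v => by
    have := ((hd1.contDiffAt (hU.mem_nhds hx)).differentiableAt one_ne_zero).hasFDerivAt
    simpa using this.clm_apply (hasFDerivAt_const m x)
  have hda : ∀ x ∈ U, ∀ v, fderiv ℝ (fun y => fderiv ℝ φ y ek) x v =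
      fderiv ℝ (fderiv ℝ φ) x v ek := fun x hx v => by rw [(hder x hx ek v).fderiv]; rfl
  have hdb : ∀ x ∈ U, ∀ v, fderiv ℝ (fun y => η y • fderiv ℝ φ y el) x v =
      η x • fderiv ℝ (fderiv ℝ φ) x v el + fderiv ℝ η x v • fderiv ℝ φ x el := fun x hx v => by
    rw [((hη1.differentiable one_ne_zero x).hasFDerivAt.fun_smul (hder x hx el v)).fderiv]
    simp
  have hR : ContinuousOn (riemannTensor φ i j k l) U :=
    (((hc2 _ _).inner (hc2 _ _)).sub ((hc2 _ _).inner (hc2 _ _))).add (hquad i j k l)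
  have int1 : Integrable (fun x => riemannTensor φ i j k l x * η x) := by
    refine Continuous.integrable_of_hasCompactSupport ?_ hηc.mul_left
    refine (hR.mul hη1.continuous.continuousOn).continuous_of_tsupport_subset hU ?_
    exact (tsupport_mul_subset_right).trans hηU
  have int2 : ∀ v w : Coord n, Integrable (fun x => inner ℝ (fderiv ℝ (fun y => fderiv ℝ φ y ek) x v)
      (fderiv ℝ (fun y => η y • fderiv ℝ φ y el) x w)) := by
    intro v w
    have hsupp : Function.support (fun x => inner ℝ (fderiv ℝ (fun y => fderiv ℝ φ y ek) x v)
        (fderiv ℝ (fun y => η y • fderiv ℝ φ y el) x w)) ⊆ tsupport η := by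
      intro x hx
      by_contra hxs
      refine hx ?_
      have : fderiv ℝ (fun y => η y • fderiv ℝ φ y el) x = 0 := by
        by_contra h
        exact hxs (hbts (support_fderiv_subset ℝ h))
      simp [this]
    refine Continuous.integrable_of_hasCompactSupport ?_
      (hηc.of_isClosed_subset (isClosed_tsupport _) (closure_minimal hsupp (isClosed_tsupport _)))
    refine ContinuousOn.continuous_of_tsupport_subset (ContinuousOn.inner ?_ ?_) hU
      ((closure_minimal hsupp (isClosed_tsupport _)).trans hηU)
    · exact (ha.continuousOn_fderiv_of_isOpen hU le_rfl).clm_apply continuousOn_const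
    · exact ((hb.continuous_fderiv one_ne_zero).clm_apply continuous_const).continuousOn
  -- Off `tsupport η` nothing is known about `φ`, but each term has a factor `η`, a derivative of
  -- `η`, or a derivative of `η ∂_l φ`.
  have pt : ∀ x, christoffel (inducedMetric φ) i k l x * pd j η x -
      christoffel (inducedMetric φ) j k l x * pd i η x +
        quadraticPart (inducedMetric φ) i j k l x * η x =
      riemannTensor φ i j k l x * η x +
        (inner ℝ (fderiv ℝ (fun y => fderiv ℝ φ y ek) x ei)
          (fderiv ℝ (fun y => η y • fderiv ℝ φ y el) x ej) -
        inner ℝ (fderiv ℝ (fun y => fderiv ℝ φ y ek) x ej)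
          (fderiv ℝ (fun y => η y • fderiv ℝ φ y el) x ei)) := by
    intro x
    by_cases hx : x ∈ tsupport η
    · have hxU := hηU hx
      rw [hda x hxU, hda x hxU, hdb x hxU, hdb x hxU, christoffel_inducedMetric (hat x hxU),
        christoffel_inducedMetric (hat x hxU), riemannTensor, pd, pd]
      simp only [inner_add_right, inner_smul_right]
      ring
    · have h1 : η x = 0 := image_eq_zero_of_notMem_tsupport hx
      have h2 : fderiv ℝ η x = 0 := by
        by_contra h
        exact hx (support_fderiv_subset ℝ h)
      have h3 : fderiv ℝ (fun y => η y • fderiv ℝ φ y el) x = 0 := by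
        by_contra h
        exact hx (hbts (support_fderiv_subset ℝ h))
      simp [pd, h1, h2, h3]
  simp_rw [pt]
  have e2 := integral_sub (int2 ei ej) (int2 ej ei)
  have e1 := integral_add int1 ((int2 ei ej).sub (int2 ej ei))
  simp only [Pi.sub_apply] at e1
  rw [e1, e2, main, sub_self, add_zero]

/-- The Gauss equation. -/
theorem sum_riemannTensor (hU : IsOpen U) (hφ : ContDiffOn ℝ 2 φ U) {x : Coord n} (hx : x ∈ U)
    (hinj : Function.Injective (fderiv ℝ φ x)) {N : Ambient n} (hN : N ≠ 0)
    (hND : ∀ z, inner ℝ N (fderiv ℝ φ x z) = 0) (a b : Coord n) :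
    ∑ i, ∑ j, ∑ k, ∑ l, riemannTensor φ i j k l x * a i * b j * b k * a l =
      (inner ℝ (fderiv ℝ (fderiv ℝ φ) x a a) N * inner ℝ (fderiv ℝ (fderiv ℝ φ) x b b) N -
        inner ℝ (fderiv ℝ (fderiv ℝ φ) x a b) N * inner ℝ (fderiv ℝ (fderiv ℝ φ) x b a) N) /
        inner ℝ N N := by
  have hat : ContDiffAt ℝ 2 φ x := hφ.contDiffAt (hU.mem_nhds hx)
  set h : Fin n → Fin n → ℝ := fun i j => inner ℝ (fderiv ℝ (fderiv ℝ φ) x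
    (EuclideanSpace.single i 1) (EuclideanSpace.single j 1)) N with hh
  have hR : ∀ i j k l, riemannTensor φ i j k l x =
      (h j k * h i l - h i k * h j l) / inner ℝ N N := by
    intro i j k l
    have hq : quadraticPart (inducedMetric φ) i j k l x = _ :=
      (Finset.sum_congr rfl fun p _ => Finset.sum_congr rfl fun q _ => by
        rw [christoffel_inducedMetric hat, christoffel_inducedMetric hat,
          christoffel_inducedMetric hat, christoffel_inducedMetric hat, mul_sub])
    simp_rw [Finset.sum_sub_distrib] at hq
    -- The quadratic part pairs tangential components, so in the sum only the components along `N`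
    -- survive.
    have h1 := sum_gram_inv_mul hinj hN hND (fderiv ℝ (fderiv ℝ φ) x
      (EuclideanSpace.single i 1) (EuclideanSpace.single k 1)) (fderiv ℝ (fderiv ℝ φ) x
      (EuclideanSpace.single j 1) (EuclideanSpace.single l 1))
    have h2 := sum_gram_inv_mul hinj hN hND (fderiv ℝ (fderiv ℝ φ) x
      (EuclideanSpace.single j 1) (EuclideanSpace.single k 1)) (fderiv ℝ (fderiv ℝ φ) x
      (EuclideanSpace.single i 1) (EuclideanSpace.single l 1))
    unfold riemannTensor
    rw [hq]
    unfold inducedMetric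
    rw [h1, h2]
    simp only [hh]
    ring
  have hbil : ∀ v w : Coord n, inner ℝ (fderiv ℝ (fderiv ℝ φ) x v w) N =
      ∑ i, ∑ j, v i * w j * h i j := by
    intro v w
    conv_lhs => rw [← sum_smul_single v, ← sum_smul_single w]
    simp only [map_sum, sum_apply, map_smul, smul_apply,
      sum_inner, inner_smul_left, hh]
    simp only [conj_trivial, Finset.mul_sum, mul_assoc]
    rw [Finset.sum_comm]
    exact Finset.sum_congr rfl fun i _ => Finset.sum_congr rfl fun j _ => by ring
  simp_rw [hR]
  rw [hbil a a, hbil b b, hbil a b, hbil b a]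
  have s1 : ∀ i j, ∑ k, ∑ l, (h j k * h i l - h i k * h j l) / inner ℝ N N *
      a i * b j * b k * a l =
      ((b j * ∑ k, b k * h j k) * (a i * ∑ l, a l * h i l) -
        (a i * ∑ k, b k * h i k) * (b j * ∑ l, a l * h j l)) / inner ℝ N N := by
    intro i j
    rw [mul_mul_mul_comm, mul_mul_mul_comm (a i), Finset.sum_mul_sum, Finset.sum_mul_sum]
    simp only [Finset.mul_sum, ← Finset.sum_sub_distrib, Finset.sum_div]
    exact Finset.sum_congr rfl fun k _ => Finset.sum_congr rfl fun l _ => by ring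
  have s2 : ∀ v w : Coord n, ∑ i, ∑ j, v i * w j * h i j = ∑ i, v i * ∑ j, w j * h i j := by
    intro v w
    simp only [Finset.mul_sum, mul_assoc]
  simp_rw [s1, s2]
  simp only [← Finset.sum_div, Finset.sum_sub_distrib, ← Finset.mul_sum, ← Finset.sum_mul]
  ring

end FocalSheet

/-! ### Principal fields and the second fundamental form of the focal sheet -/

/-- An operator depending on a parameter in a `C¹` way is invertible near a point where it is
injective, and its inverse depends on the parameter in a `C¹` way. -/
theorem exists_contDiffAt_leftInverse {E V : Type*} [NormedAddCommGroup E] [NormedSpace ℝ E]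
    [NormedAddCommGroup V] [NormedSpace ℝ V] [FiniteDimensional ℝ V] {T : E → V →L[ℝ] V} {x₀ : E}
    (hT : ContDiffAt ℝ 1 T x₀) (hinj : Function.Injective (T x₀)) :
    ∃ S : E → V →L[ℝ] V, ContDiffAt ℝ 1 S x₀ ∧ ∀ᶠ x in 𝓝 x₀, ∀ v, S x (T x v) = v := by
  have : CompleteSpace V := FiniteDimensional.complete ℝ V
  have hu : IsUnit (T x₀) := by
    rw [ContinuousLinearMap.isUnit_iff_bijective]
    exact ⟨hinj, LinearMap.injective_iff_surjective.1 hinj⟩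
  obtain ⟨u, hu⟩ := hu
  refine ⟨fun x => Ring.inverse (T x), ?_, ?_⟩
  · have h := contDiffAt_ringInverse ℝ u (n := 1)
    rw [hu] at h
    exact h.comp x₀ hT
  · have h : ∀ᶠ x in 𝓝 x₀, IsUnit (T x) := by
      refine hT.continuousAt.eventually ?_
      rw [← hu]
      exact Units.nhds u
    filter_upwards [h] with x hx v
    exact DFunLike.congr_fun (Ring.inverse_mul_cancel _ hx) v

namespace FocalSheet

variable {n : ℕ} {ι ν : Coord n → Ambient n} {x₀ : Coord n}

theorem fderiv_clm_apply_fun {E F G : Type*} [NormedAddCommGroup E] [NormedSpace ℝ E]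
    [NormedAddCommGroup F] [NormedSpace ℝ F] [NormedAddCommGroup G] [NormedSpace ℝ G]
    {L : E → F →L[ℝ] G} {Z : E → F} {x : E} (hL : DifferentiableAt ℝ L x)
    (hZ : DifferentiableAt ℝ Z x) (w : E) :
    fderiv ℝ (fun y => L y (Z y)) x w = fderiv ℝ L x w (Z x) + L x (fderiv ℝ Z x w) := by
  rw [(hL.hasFDerivAt.clm_apply hZ.hasFDerivAt).fderiv]
  simp [add_comm]

/-- A function with a vanishing inner product with the differential of `φ`: the second fundamental
form in terms of its derivative. -/
theorem inner_fderiv_fderiv_eq_neg {φ N : Coord n → Ambient n}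
    (hφ : ContDiffAt ℝ 2 φ x₀) (hN : DifferentiableAt ℝ N x₀)
    (h : ∀ᶠ y in 𝓝 x₀, ∀ z, inner ℝ (N y) (fderiv ℝ φ y z) = 0) (v w : Coord n) :
    inner ℝ (fderiv ℝ (fderiv ℝ φ) x₀ v w) (N x₀) =
      -inner ℝ (fderiv ℝ N x₀ v) (fderiv ℝ φ x₀ w) := by
  have hd : DifferentiableAt ℝ (fderiv ℝ φ) x₀ :=
    (hφ.fderiv_right (m := 1) le_rfl).differentiableAt one_ne_zero
  have hdw : DifferentiableAt ℝ (fun y => fderiv ℝ φ y w) x₀ :=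
    hd.clm_apply (differentiableAt_const w)
  have h0 : (fun y => inner ℝ (N y) (fderiv ℝ φ y w)) =ᶠ[𝓝 x₀] fun _ => 0 := h.mono fun y hy => hy w
  have h1 := fderiv_inner_apply ℝ hN hdw v
  rw [h0.fderiv_eq, fderiv_clm_apply_fun hd (differentiableAt_const w)] at h1
  simp only [fderiv_fun_const, Pi.zero_apply, zero_apply, map_zero,
    add_zero] at h1
  rw [real_inner_comm]
  linarith

/-- Both sides equal `-⟨D²ι(v, w), ν⟩`. -/
theorem inner_fderiv_symm (hι : ContDiffAt ℝ 2 ι x₀) (hν : DifferentiableAt ℝ ν x₀)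
    (h : ∀ᶠ y in 𝓝 x₀, ∀ z, inner ℝ (ν y) (fderiv ℝ ι y z) = 0) (v w : Coord n) :
    inner ℝ (fderiv ℝ ν x₀ v) (fderiv ℝ ι x₀ w) =
      inner ℝ (fderiv ℝ ν x₀ w) (fderiv ℝ ι x₀ v) := by
  have h1 := inner_fderiv_fderiv_eq_neg hι hν h v w
  rw [(hι.isSymmSndFDerivAt (by simp)) v w, inner_fderiv_fderiv_eq_neg hι hν h w v] at h1
  linarith

theorem inner_fderiv_of_norm_eq_one (hν : DifferentiableAt ℝ ν x₀)
    (h : ∀ᶠ y in 𝓝 x₀, ‖ν y‖ = 1) (v : Coord n) : inner ℝ (ν x₀) (fderiv ℝ ν x₀ v) = 0 := by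
  have h0 : (fun y => inner ℝ (ν y) (ν y)) =ᶠ[𝓝 x₀] fun _ => (1 : ℝ) := by
    filter_upwards [h] with y hy
    rw [real_inner_self_eq_norm_sq, hy, one_pow]
  have h1 := fderiv_inner_apply ℝ hν hν v
  rw [h0.fderiv_eq, real_inner_comm (ν x₀)] at h1
  simp only [fderiv_fun_const, Pi.zero_apply, zero_apply] at h1
  linarith

/-- Simple principal directions can be normalised so as to form a `C¹` field. -/
theorem exists_principal_field {ρ : Coord n → ℝ} {X : Coord n → Coord n}
    (hι : ContDiffAt ℝ 2 ι x₀) (hν : ContDiffAt ℝ 2 ν x₀) (hρ : ContDiffAt ℝ 1 ρ x₀)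
    (hinj : Function.Injective (fderiv ℝ ι x₀))
    (horth : ∀ᶠ y in 𝓝 x₀, ∀ z, inner ℝ (ν y) (fderiv ℝ ι y z) = 0)
    (hnorm : ∀ᶠ y in 𝓝 x₀, ‖ν y‖ = 1)
    (hX : ∀ᶠ y in 𝓝 x₀, ρ y • fderiv ℝ ν y (X y) = fderiv ℝ ι y (X y) ∧ X y ≠ 0)
    (hsimple : ∀ z, ρ x₀ • fderiv ℝ ν x₀ z = fderiv ℝ ι x₀ z → ∃ c : ℝ, z = c • X x₀) :
    ∃ Z : Coord n → Coord n, ContDiffAt ℝ 1 Z x₀ ∧ Z x₀ = X x₀ ∧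
      ∀ᶠ y in 𝓝 x₀, ρ y • fderiv ℝ ν y (Z y) = fderiv ℝ ι y (Z y) := by
  have hdι : ContDiffAt ℝ 1 (fderiv ℝ ι) x₀ := hι.fderiv_right le_rfl
  have hdν : ContDiffAt ℝ 1 (fderiv ℝ ν) x₀ := hν.fderiv_right le_rfl
  have hν' := hν.differentiableAt two_ne_zero
  have hX0 := hX.self_of_nhds
  have hnorm0 := hnorm.self_of_nhds
  have hν0 : ν x₀ ≠ 0 := fun h => by simp [h] at hnorm0
  set X₀ := X x₀ with hX₀
  -- A rank-one term makes the singular operator `ρ dν - dι` invertible. At `x₀` the first summand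
  -- has range orthogonal to `X₀` by symmetry, so a kernel vector of `T x₀` is both orthogonal to
  -- `X₀` and, by simplicity, a multiple of it. Nearby, `T y` maps `X y` to a multiple of `X₀`, so
  -- `(T y)⁻¹ X₀` is principal even if `X` is not continuous.
  let T : Coord n → Coord n →L[ℝ] Coord n := fun y =>
    (ContinuousLinearMap.adjoint (fderiv ℝ ι x₀)).comp (ρ y • fderiv ℝ ν y - fderiv ℝ ι y) +
      (innerSL ℝ X₀).smulRight X₀
  have hTapp : ∀ y v, T y v = ContinuousLinearMap.adjoint (fderiv ℝ ι x₀)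
      (ρ y • fderiv ℝ ν y v - fderiv ℝ ι y v) + inner ℝ X₀ v • X₀ := fun y v => by simp [T]
  have hT : ContDiffAt ℝ 1 T x₀ :=
    (contDiffAt_const.clm_comp ((hρ.smul hdν).sub hdι)).add contDiffAt_const
  have hXX : inner ℝ X₀ X₀ ≠ (0 : ℝ) := inner_self_ne_zero.2 hX0.2
  have hTinj : Function.Injective (T x₀) := by
    rw [injective_iff_map_eq_zero]
    intro v hv
    rw [hTapp] at hv
    have hAX : inner ℝ (fderiv ℝ ι x₀ X₀) (ρ x₀ • fderiv ℝ ν x₀ v - fderiv ℝ ι x₀ v) = 0 := by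
      rw [inner_sub_right, inner_smul_right, real_inner_comm,
        inner_fderiv_symm hι hν' horth, ← real_inner_smul_left, hX0.1, sub_self]
    have h1 : inner ℝ X₀ v = 0 := by
      have := congrArg (fun z => inner ℝ X₀ z) hv
      simp only [inner_add_right, ContinuousLinearMap.adjoint_inner_right, hAX, inner_smul_right,
        inner_zero_right, zero_add, mul_eq_zero] at this
      exact this.resolve_right hXX
    rw [h1, zero_smul, add_zero] at hv
    have h2 : ρ x₀ • fderiv ℝ ν x₀ v - fderiv ℝ ι x₀ v = 0 := by
      refine eq_zero_of_orthogonal_range hinj hν0 horth.self_of_nhds (fun z => ?_) ?_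
      · rw [← ContinuousLinearMap.adjoint_inner_left, hv, inner_zero_left]
      · rw [inner_sub_right, inner_smul_right, inner_fderiv_of_norm_eq_one hν' hnorm,
          horth.self_of_nhds, mul_zero, sub_zero]
    obtain ⟨c, rfl⟩ := hsimple v (sub_eq_zero.1 h2)
    rw [inner_smul_right, mul_eq_zero] at h1
    rw [h1.resolve_right hXX, zero_smul]
  obtain ⟨S, hS, hST⟩ := exists_contDiffAt_leftInverse hT hTinj
  have hTX : ∀ y, ρ y • fderiv ℝ ν y (X y) = fderiv ℝ ι y (X y) →
      T y (X y) = inner ℝ X₀ (X y) • X₀ := fun y hy => by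
    rw [hTapp, hy, sub_self, map_zero, zero_add]
  -- The factor `⟨X₀, X₀⟩` makes the field equal to `X₀` at `x₀`.
  refine ⟨fun y => S y ((inner ℝ X₀ X₀ : ℝ) • X₀), hS.clm_apply contDiffAt_const, ?_, ?_⟩
  · change S x₀ _ = X₀
    rw [← hTX x₀ hX0.1, hST.self_of_nhds]
  · filter_upwards [hST, hX] with y hy hXy
    have h1 := hy (X y)
    rw [hTX y hXy.1, map_smul] at h1
    have h2 : (inner ℝ X₀ (X y) : ℝ) ≠ 0 := fun h => hXy.2 (by rw [← h1, h, zero_smul])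
    have h3 : S y X₀ = (inner ℝ X₀ (X y) : ℝ)⁻¹ • X y := by
      rw [eq_inv_smul_iff₀ h2, h1]
    rw [map_smul, h3, map_smul, map_smul, map_smul, map_smul, ← hXy.1]
    module

/-- Two such identities, each principal field being differentiated along the other, combine to the
Codazzi equation in `focal_curvature`. -/
theorem fderiv_principal {ρ : Coord n → ℝ} {Z : Coord n → Coord n}
    (hι : ContDiffAt ℝ 2 ι x₀) (hν : ContDiffAt ℝ 2 ν x₀) (hρ : DifferentiableAt ℝ ρ x₀)
    (hZ : DifferentiableAt ℝ Z x₀)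
    (h : ∀ᶠ y in 𝓝 x₀, ρ y • fderiv ℝ ν y (Z y) = fderiv ℝ ι y (Z y)) (w : Coord n) :
    ρ x₀ • (fderiv ℝ (fderiv ℝ ν) x₀ w (Z x₀) + fderiv ℝ ν x₀ (fderiv ℝ Z x₀ w)) +
        fderiv ℝ ρ x₀ w • fderiv ℝ ν x₀ (Z x₀) =
      fderiv ℝ (fderiv ℝ ι) x₀ w (Z x₀) + fderiv ℝ ι x₀ (fderiv ℝ Z x₀ w) := by
  have hdι : DifferentiableAt ℝ (fderiv ℝ ι) x₀ :=
    (hι.fderiv_right (m := 1) le_rfl).differentiableAt one_ne_zero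
  have hdν : DifferentiableAt ℝ (fderiv ℝ ν) x₀ :=
    (hν.fderiv_right (m := 1) le_rfl).differentiableAt one_ne_zero
  have h0 : (fun y => ρ y • fderiv ℝ ν y (Z y)) =ᶠ[𝓝 x₀] fun y => fderiv ℝ ι y (Z y) := h
  have h1 := DFunLike.congr_fun (h0.fderiv_eq (𝕜 := ℝ)) w
  rw [fderiv_clm_apply_fun hdι hZ, (hρ.hasFDerivAt.fun_smul
    (hdν.clm_apply hZ).hasFDerivAt).fderiv] at h1
  rw [← h1]
  simp only [add_apply, smul_apply, ContinuousLinearMap.smulRight_apply,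
    fderiv_clm_apply_fun hdν hZ]

theorem fderiv_focalMap {ρ : Coord n → ℝ}
    (hι : DifferentiableAt ℝ ι x₀) (hν : DifferentiableAt ℝ ν x₀) (hρ : DifferentiableAt ℝ ρ x₀)
    (w : Coord n) :
    fderiv ℝ (fun y => ι y - ρ y • ν y) x₀ w =
      fderiv ℝ ι x₀ w - ρ x₀ • fderiv ℝ ν x₀ w - fderiv ℝ ρ x₀ w • ν x₀ := by
  rw [(hι.hasFDerivAt.fun_sub (hρ.hasFDerivAt.fun_smul hν.hasFDerivAt)).fderiv]
  simp only [sub_apply, add_apply, smul_apply, ContinuousLinearMap.smulRight_apply]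
  abel

/-- The principal direction is normal to the focal sheet. -/
theorem inner_fderiv_focalMap {ρ : Coord n → ℝ} {z : Coord n}
    (hι : ContDiffAt ℝ 2 ι x₀) (hν : DifferentiableAt ℝ ν x₀) (hρ : DifferentiableAt ℝ ρ x₀)
    (horth : ∀ᶠ y in 𝓝 x₀, ∀ z, inner ℝ (ν y) (fderiv ℝ ι y z) = 0)
    (hz : ρ x₀ • fderiv ℝ ν x₀ z = fderiv ℝ ι x₀ z) (w : Coord n) :
    inner ℝ (fderiv ℝ ι x₀ z) (fderiv ℝ (fun y => ι y - ρ y • ν y) x₀ w) = 0 := by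
  rw [fderiv_focalMap (hι.differentiableAt two_ne_zero) hν hρ, inner_sub_right, inner_sub_right,
    inner_smul_right, inner_smul_right, real_inner_comm (ν x₀), horth.self_of_nhds, mul_zero,
    sub_zero, real_inner_comm (fderiv ℝ ν x₀ w), inner_fderiv_symm hι hν horth w z,
    ← real_inner_smul_left, hz, sub_self]

/-- The second fundamental form of a focal sheet in terms of its normal field `Dι(Z)`. -/
theorem focal_curvature {ρ σ : Coord n → ℝ} {Z W : Coord n → Coord n}
    (hι : ContDiffAt ℝ 2 ι x₀) (hν : ContDiffAt ℝ 2 ν x₀)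
    (hρ : DifferentiableAt ℝ ρ x₀) (hσ : DifferentiableAt ℝ σ x₀)
    (hinj : Function.Injective (fderiv ℝ ι x₀))
    (horth : ∀ᶠ y in 𝓝 x₀, ∀ z, inner ℝ (ν y) (fderiv ℝ ι y z) = 0)
    (hnorm : ∀ᶠ y in 𝓝 x₀, ‖ν y‖ = 1)
    (hZ : DifferentiableAt ℝ Z x₀) (hW : DifferentiableAt ℝ W x₀)
    (hρZ : ∀ᶠ y in 𝓝 x₀, ρ y • fderiv ℝ ν y (Z y) = fderiv ℝ ι y (Z y))
    (hσW : ∀ᶠ y in 𝓝 x₀, σ y • fderiv ℝ ν y (W y) = fderiv ℝ ι y (W y))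
    (hne : ρ x₀ ≠ σ x₀) (hρ1 : fderiv ℝ ρ x₀ (Z x₀) = 1) (hσ1 : fderiv ℝ σ x₀ (W x₀) = 1)
    {f N : Coord n → Ambient n} (hf : f = fun y => ι y - ρ y • ν y)
    (hN : N = fun y => fderiv ℝ ι y (Z y)) :
    inner ℝ (fderiv ℝ N x₀ (W x₀)) (fderiv ℝ f x₀ (Z x₀)) = 0 ∧
    LinearIndependent ℝ ![fderiv ℝ f x₀ (Z x₀), fderiv ℝ f x₀ (W x₀)] ∧
    (fderiv ℝ (fun y => ρ y - σ y) x₀ (Z x₀) - 1) / (ρ x₀ - σ x₀) ^ 2 =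
      inner ℝ (fderiv ℝ N x₀ (Z x₀)) (fderiv ℝ f x₀ (Z x₀)) *
        inner ℝ (fderiv ℝ N x₀ (W x₀)) (fderiv ℝ f x₀ (W x₀)) / inner ℝ (N x₀) (N x₀) /
        (inner ℝ (fderiv ℝ f x₀ (Z x₀)) (fderiv ℝ f x₀ (Z x₀)) *
          inner ℝ (fderiv ℝ f x₀ (W x₀)) (fderiv ℝ f x₀ (W x₀)) -
          inner ℝ (fderiv ℝ f x₀ (Z x₀)) (fderiv ℝ f x₀ (W x₀)) ^ 2) := by
  have hι' := hι.differentiableAt two_ne_zero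
  have hν' := hν.differentiableAt two_ne_zero
  have hdι : DifferentiableAt ℝ (fderiv ℝ ι) x₀ :=
    (hι.fderiv_right (m := 1) le_rfl).differentiableAt one_ne_zero
  have symm := inner_fderiv_symm hι hν' horth
  have hνν := inner_fderiv_of_norm_eq_one hν' hnorm
  have hνι := horth.self_of_nhds
  have hZ0 := hρZ.self_of_nhds
  have hW0 := hσW.self_of_nhds
  have dZ := fderiv_principal hι hν hρ hZ hρZ (W x₀)
  have dW := fderiv_principal hι hν hσ hW hσW (Z x₀)
  have hNd : ∀ w, fderiv ℝ N x₀ w =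
      fderiv ℝ (fderiv ℝ ι) x₀ w (Z x₀) + fderiv ℝ ι x₀ (fderiv ℝ Z x₀ w) := fun w => by
    rw [hN, fderiv_clm_apply_fun hdι hZ]
  have hNW := hNd (W x₀)
  have hN0 : N x₀ = fderiv ℝ ι x₀ (Z x₀) := by rw [hN]
  have hNν : ∀ w, inner ℝ (fderiv ℝ N x₀ w) (ν x₀) = -inner ℝ (N x₀) (fderiv ℝ ν x₀ w) := by
    intro w
    have hNdiff : DifferentiableAt ℝ N x₀ := by rw [hN]; exact hdι.clm_apply hZ
    have h0 : (fun y => inner ℝ (N y) (ν y)) =ᶠ[𝓝 x₀] fun _ => (0 : ℝ) := by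
      filter_upwards [horth] with y hy
      rw [hN, real_inner_comm, hy]
    have h1 := fderiv_inner_apply ℝ hNdiff hν' w
    rw [h0.fderiv_eq] at h1
    simp only [fderiv_fun_const, Pi.zero_apply, zero_apply] at h1
    linarith
  have symι : fderiv ℝ (fderiv ℝ ι) x₀ (W x₀) (Z x₀) = fderiv ℝ (fderiv ℝ ι) x₀ (Z x₀) (W x₀) :=
    hι.isSymmSndFDerivAt (by simp) _ _
  have symν : fderiv ℝ (fderiv ℝ ν) x₀ (W x₀) (Z x₀) = fderiv ℝ (fderiv ℝ ν) x₀ (Z x₀) (W x₀) :=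
    hν.isSymmSndFDerivAt (by simp) _ _
  have hfd : ∀ w, fderiv ℝ f x₀ w = fderiv ℝ ι x₀ w - ρ x₀ • fderiv ℝ ν x₀ w -
      fderiv ℝ ρ x₀ w • ν x₀ := fun w => by rw [hf, fderiv_focalMap hι' hν' hρ]
  have hsd : fderiv ℝ (fun y => ρ y - σ y) x₀ (Z x₀) = 1 - fderiv ℝ σ x₀ (Z x₀) := by
    rw [fderiv_fun_sub hρ hσ, sub_apply, hρ1]
  have hZne : Z x₀ ≠ 0 := fun h => by rw [h, map_zero] at hρ1; exact zero_ne_one hρ1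
  have hWne : W x₀ ≠ 0 := fun h => by rw [h, map_zero] at hσ1; exact zero_ne_one hσ1
  have hDZne : fderiv ℝ ι x₀ (Z x₀) ≠ 0 := fun h => hZne (hinj (by rw [h, map_zero]))
  have hDWne : fderiv ℝ ι x₀ (W x₀) ≠ 0 := fun h => hWne (hinj (by rw [h, map_zero]))
  have hρne : ρ x₀ ≠ 0 := fun h => hDZne (by rw [← hZ0, h, zero_smul])
  have hσne : σ x₀ ≠ 0 := fun h => hDWne (by rw [← hW0, h, zero_smul])
  have hνn : inner ℝ (ν x₀) (ν x₀) = (1 : ℝ) := by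
    rw [real_inner_self_eq_norm_sq, hnorm.self_of_nhds, one_pow]
  set r := ρ x₀
  set s := σ x₀
  set X := Z x₀
  set Y := W x₀
  set D := fderiv ℝ ι x₀
  set B := fderiv ℝ ν x₀
  have hBZ : B X = r⁻¹ • D X := by rw [eq_inv_smul_iff₀ hρne, hZ0]
  have hBW : B Y = s⁻¹ • D Y := by rw [eq_inv_smul_iff₀ hσne, hW0]
  have hZW : inner ℝ (D X) (D Y) = (0 : ℝ) := by
    have := symm X Y
    rw [hBZ, hBW, real_inner_smul_left, real_inner_smul_left, real_inner_comm (D X),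
      ← sub_eq_zero, ← sub_mul, mul_eq_zero, sub_eq_zero, inv_inj] at this
    exact this.resolve_left hne
  have hfX : fderiv ℝ f x₀ X = -ν x₀ := by rw [hfd, hZ0, sub_self, hρ1, one_smul, zero_sub]
  have hfY : fderiv ℝ f x₀ Y = (1 - r / s) • D Y - fderiv ℝ ρ x₀ Y • ν x₀ := by
    rw [hfd, hBW, smul_smul, sub_smul, one_smul, div_eq_mul_inv]
  have hNYν : inner ℝ (fderiv ℝ N x₀ Y) (ν x₀) = (0 : ℝ) := by
    rw [hNν, hN0, hBW, inner_smul_right, hZW, mul_zero, neg_zero]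
  have hNXν : inner ℝ (fderiv ℝ N x₀ X) (ν x₀) = -(r⁻¹ * inner ℝ (D X) (D X)) := by
    rw [hNν, hN0, hBZ, inner_smul_right]
  have hcoef : 1 - r / s ≠ 0 := fun h => hne (by field_simp at h; linarith)
  -- Both differentiated eigenvector equations are paired with `D Y`. The derivative of `W` cancels
  -- since `s ⟨B v, D Y⟩ = ⟨D v, D Y⟩`; second derivatives commute, and eliminating that of `ν`
  -- leaves this relation.
  have codazzi : fderiv ℝ σ x₀ X * inner ℝ (D Y) (D Y) * r =
      inner ℝ (fderiv ℝ N x₀ Y) (D Y) * (r - s) * s := by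
    have e1 := congrArg (fun z => inner ℝ z (D Y)) dZ
    have e2 := congrArg (fun z => inner ℝ z (D Y)) dW
    have e3 := congrArg (fun z => inner ℝ z (D Y)) hNW
    have e4 := symm (fderiv ℝ Z x₀ Y) Y
    have e5 := symm (fderiv ℝ W x₀ X) Y
    simp only [inner_add_left, real_inner_smul_left, hBZ, hBW, hZW, symι, symν] at e1 e2 e3 e4 e5
    rw [e4] at e1
    rw [e5] at e2
    rw [real_inner_comm (D (fderiv ℝ Z x₀ Y))] at e1
    rw [real_inner_comm (D (fderiv ℝ W x₀ X))] at e2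
    rw [e3]
    generalize inner ℝ (fderiv ℝ (fderiv ℝ ν) x₀ X Y) (D Y) = P at *
    generalize inner ℝ (fderiv ℝ (fderiv ℝ ι) x₀ X Y) (D Y) = Q at *
    generalize inner ℝ (D (fderiv ℝ Z x₀ Y)) (D Y) = R at *
    generalize inner ℝ (D (fderiv ℝ W x₀ X)) (D Y) = R' at *
    generalize inner ℝ (D Y) (D Y) = y at *
    generalize fderiv ℝ σ x₀ X = t at *
    field_simp at e1 e2
    have e1' : r * (P * s + R) = s * (Q + R) := mul_left_cancel₀ hρne (by linear_combination e1)
    linear_combination r * e2 - s * e1'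
  refine ⟨?_, ?_, ?_⟩
  · rw [hfX, inner_neg_right, hNYν, neg_zero]
  · rw [hfX, hfY, LinearIndependent.pair_iff]
    intro a b hab
    have h1 := congrArg (fun z => inner ℝ z (D Y)) hab
    simp only [inner_add_left, real_inner_smul_left, inner_sub_left, inner_neg_left, hνι,
      inner_zero_left, mul_zero, neg_zero, sub_zero, zero_add, mul_eq_zero, hcoef,
      inner_self_eq_zero, hDWne, or_false] at h1
    subst h1
    have h2 := congrArg (fun z => inner ℝ z (ν x₀)) hab
    have hν0 : ν x₀ ≠ 0 := fun h => by simp [h] at hνn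
    simpa [inner_add_left, real_inner_smul_left, hνn, hν0] using h2
  · have hyy : inner ℝ (D Y) (D Y) ≠ (0 : ℝ) := inner_self_ne_zero.2 hDWne
    have hxx : inner ℝ (D X) (D X) ≠ (0 : ℝ) := inner_self_ne_zero.2 hDZne
    have hYν : inner ℝ (D Y) (ν x₀) = (0 : ℝ) := by rw [real_inner_comm]; exact hνι Y
    have hrs : r - s ≠ 0 := sub_ne_zero.2 hne
    rw [hsd, hfX, hfY, hN0]
    simp only [inner_sub_left, inner_sub_right, inner_neg_left, inner_neg_right,
      real_inner_smul_left, inner_smul_right, hNXν, hNYν, hνn, hνι, hYν]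
    generalize inner ℝ (D Y) (D Y) = y at *
    generalize inner ℝ (D X) (D X) = x at *
    generalize inner ℝ (fderiv ℝ N x₀ Y) (D Y) = m at *
    generalize fderiv ℝ σ x₀ X = t at *
    generalize fderiv ℝ ρ x₀ Y = t' at *
    have ht : t = m * (r - s) * s / (y * r) := by
      rw [eq_div_iff (mul_ne_zero hyy hρne), ← codazzi]
      ring
    have hsr : s - r ≠ 0 := sub_ne_zero.2 hne.symm
    rw [ht]
    have hden : (1 - r / s) = (s - r) / s := by field_simp
    simp only [hden, mul_zero, sub_zero, zero_sub, neg_neg, mul_neg, mul_one, one_mul, neg_zero]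
    -- The `ν`-component `t'` drops out of the area because `df(X) = -ν`.
    have hdet : (s - r) / s * ((s - r) / s * y) + t' * t' - t' ^ 2 = (s - r) ^ 2 / s ^ 2 * y := by
      field_simp
      ring
    simp only [sub_neg_eq_add]
    rw [hdet]
    field_simp
    ring

/-! ### Reparametrisation of `C¹` immersions -/

variable {n : ℕ} {F : Coord n → Ambient n} {x₀ : Coord n}

/-- Orthogonal projection to the tangent space straightens an immersion. -/
theorem exists_straightening (hF : ContDiffAt ℝ 1 F x₀) (hinj : Function.Injective (fderiv ℝ F x₀)) :
    ∃ e : OpenPartialHomeomorph (Coord n) (Coord n), x₀ ∈ e.source ∧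
      (∀ x, e x = ContinuousLinearMap.adjoint (fderiv ℝ F x₀) (F x)) ∧
      ContDiffAt ℝ 1 e.symm (e x₀) := by
  set P := ContinuousLinearMap.adjoint (fderiv ℝ F x₀) with hP
  have hPD : Function.Injective (P.comp (fderiv ℝ F x₀)) := by
    rw [injective_iff_map_eq_zero]
    intro v hv
    have h1 : inner ℝ (P (fderiv ℝ F x₀ v)) v = 0 := by
      rw [show P (fderiv ℝ F x₀ v) = 0 from hv, inner_zero_left]
    rw [hP, ContinuousLinearMap.adjoint_inner_left, inner_self_eq_zero] at h1
    exact hinj (by rw [h1, map_zero])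
  let L : Coord n ≃L[ℝ] Coord n := ContinuousLinearEquiv.ofBijective (P.comp (fderiv ℝ F x₀))
    (LinearMap.ker_eq_bot.2 hPD)
    (LinearMap.range_eq_top.2 (LinearMap.injective_iff_surjective.1 hPD))
  have hf : ContDiffAt ℝ 1 (fun x => P (F x)) x₀ := P.contDiff.contDiffAt.comp x₀ hF
  have hf' : HasFDerivAt (fun x => P (F x)) (L : Coord n →L[ℝ] Coord n) x₀ :=
    P.hasFDerivAt.comp x₀ (hF.differentiableAt one_ne_zero).hasFDerivAt
  exact ⟨hf.toOpenPartialHomeomorph _ hf' one_ne_zero,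
    hf.mem_toOpenPartialHomeomorph_source hf' one_ne_zero, fun x => rfl,
    hf.to_localInverse hf' one_ne_zero⟩

/-- A continuous lift of a differentiable map through an immersion is differentiable. -/
theorem differentiableAt_of_comp_immersion (hF : ContDiffAt ℝ 1 F x₀)
    (hinj : Function.Injective (fderiv ℝ F x₀)) {φ : Coord n → Ambient n} {τ : Coord n → Coord n}
    {y₀ : Coord n} (hφ : DifferentiableAt ℝ φ y₀) (hτ : ContinuousAt τ y₀) (hτ₀ : τ y₀ = x₀)
    (h : ∀ᶠ y in 𝓝 y₀, φ y = F (τ y)) : DifferentiableAt ℝ τ y₀ := by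
  obtain ⟨e, he, heF, hes⟩ := exists_straightening hF hinj
  set P := ContinuousLinearMap.adjoint (fderiv ℝ F x₀)
  -- Continuity of `τ` keeps it inside `e.source`, where `e = P ∘ F` can be inverted.
  have h1 : τ =ᶠ[𝓝 y₀] fun y => e.symm (P (φ y)) := by
    have h2 : ∀ᶠ y in 𝓝 y₀, τ y ∈ e.source :=
      hτ.eventually (e.open_source.mem_nhds (by rw [hτ₀]; exact he))
    filter_upwards [h, h2] with y hy hy2
    rw [hy, ← heF, e.left_inv hy2]
  refine DifferentiableAt.congr_of_eventuallyEq ?_ h1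
  have h3 : P (φ y₀) = e x₀ := by rw [h.self_of_nhds, hτ₀, heF]
  have h4 : DifferentiableAt ℝ e.symm (P (φ y₀)) := by
    rw [h3]; exact hes.differentiableAt one_ne_zero
  exact h4.comp y₀ (P.differentiableAt.comp y₀ hφ)

/-- An immersion of class `C¹` with a normal field of class `C¹` is of class `C²` after a change of
parameters. -/
theorem exists_contDiffOn_two_reparametrisation (hF : ContDiffAt ℝ 1 F x₀)
    (hinj : Function.Injective (fderiv ℝ F x₀)) {N : Coord n → Ambient n}
    (hN : ContDiffAt ℝ 1 N x₀) (hN0 : N x₀ ≠ 0)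
    (h : ∀ᶠ y in 𝓝 x₀, ∀ z, inner ℝ (N y) (fderiv ℝ F y z) = 0) {V : Set (Coord n)}
    (hV : V ∈ 𝓝 x₀) :
    ∃ e : OpenPartialHomeomorph (Coord n) (Coord n), x₀ ∈ e.source ∧ e.source ⊆ V ∧
      ContDiffOn ℝ 2 (F ∘ e.symm) e.target ∧
      ∀ y ∈ e.target, Function.Injective (fderiv ℝ (F ∘ e.symm) y) := by
  obtain ⟨e, he, heF, hes⟩ := exists_straightening hF hinj
  set D := fderiv ℝ F x₀ with hD
  set P := ContinuousLinearMap.adjoint D with hP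
  -- For `φ = F ∘ e.symm` one has `P (dφ w) = w` and `dφ w ⊥ N`, hence `T (dφ w) = D w`. So `dφ =
  -- T⁻¹ D` is `C¹` like `N`, one derivative more than `F` provides.
  let T : Coord n → Ambient n →L[ℝ] Ambient n := fun y =>
    D.comp P + (innerSL ℝ (N y)).smulRight (N x₀)
  have hTapp : ∀ y v, T y v = D (P v) + inner ℝ (N y) v • N x₀ := fun y v => by simp [T]
  have hT : ContDiffAt ℝ 1 T x₀ := by
    refine contDiffAt_const.add ?_
    exact ((innerSL ℝ (E := Ambient n)).contDiff.contDiffAt.comp x₀ hN).smulRight contDiffAt_const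
  have hTinj : Function.Injective (T x₀) := by
    rw [injective_iff_map_eq_zero]
    intro v hv
    rw [hTapp] at hv
    have h1 : inner ℝ (N x₀) v = 0 := by
      have := congrArg (fun z => inner ℝ (N x₀) z) hv
      simp only [inner_add_right, h.self_of_nhds, hD, inner_smul_right, inner_zero_right, zero_add,
        mul_eq_zero, inner_self_eq_zero, hN0, or_false] at this
      exact this
    rw [h1, zero_smul, add_zero] at hv
    have h2 : P v = 0 := hinj (by rw [hv, map_zero])
    refine eq_zero_of_orthogonal_range hinj hN0 h.self_of_nhds (fun z => ?_) h1
    rw [← ContinuousLinearMap.adjoint_inner_left, ← hP, h2, inner_zero_left]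
  obtain ⟨S, hS, hST⟩ := exists_contDiffAt_leftInverse hT hTinj
  have hes' : ∀ᶠ z in 𝓝 x₀, ContDiffAt ℝ 1 e.symm (e z) :=
    (e.continuousAt he).eventually (hes.eventually (by simp))
  have hA : ∀ᶠ z in 𝓝 x₀, z ∈ V ∧ ContDiffAt ℝ 1 F z ∧ ContDiffAt ℝ 1 S z ∧
      (∀ v, S z (T z v) = v) ∧ (∀ v, inner ℝ (N z) (fderiv ℝ F z v) = 0) ∧
      ContDiffAt ℝ 1 e.symm (e z) := by
    filter_upwards [hV, hF.eventually (by simp), hS.eventually (by simp), hST, h, hes']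
      with z h1 h2 h3 h4 h5 h6 using ⟨h1, h2, h3, h4, h5, h6⟩
  obtain ⟨A, hA, hAo, hxA⟩ := eventually_nhds_iff.1 hA
  let G := e.restrOpen A hAo
  have hGs : G.source = e.source ∩ A := rfl
  have hGsymm : ∀ y, G.symm y = e.symm y := fun y => rfl
  have hGt : ∀ y ∈ G.target, G.symm y ∈ A := fun y hy => (G.map_target hy).2
  have hGe : ∀ y ∈ G.target, e (e.symm y) = y := fun y hy => G.right_inv hy
  have hsymm : ∀ y ∈ G.target, ContDiffAt ℝ 1 e.symm y := fun y hy => by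
    have := (hA _ (hGt y hy)).2.2.2.2.2
    rwa [hGsymm, hGe y hy] at this
  have hφ : ∀ y ∈ G.target, ContDiffAt ℝ 1 (F ∘ G.symm) y := fun y hy =>
    (hA _ (hGt y hy)).2.1.comp y (hsymm y hy)
  have hPφ : ∀ y ∈ G.target, ∀ w, P (fderiv ℝ (F ∘ G.symm) y w) = w := by
    intro y hy w
    have h1 : (fun y => P ((F ∘ G.symm) y)) =ᶠ[𝓝 y] id := by
      filter_upwards [G.open_target.mem_nhds hy] with y' hy'
      rw [Function.comp_apply, hGsymm, ← heF, hGe y' hy', id]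
    have h2 := (P.hasFDerivAt.comp y ((hφ y hy).differentiableAt one_ne_zero).hasFDerivAt)
    have h3 := h2.unique ((hasFDerivAt_id y).congr_of_eventuallyEq h1)
    exact DFunLike.congr_fun h3 w
  have hfd : ∀ y ∈ G.target, fderiv ℝ (F ∘ G.symm) y = (S (G.symm y)).comp D := by
    intro y hy
    obtain ⟨-, hFz, -, hSz, hNz, -⟩ := hA _ (hGt y hy)
    ext1 w
    have h1 : fderiv ℝ (F ∘ G.symm) y w = fderiv ℝ F (G.symm y) (fderiv ℝ G.symm y w) := by
      rw [fderiv_comp y (hFz.differentiableAt one_ne_zero)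
        ((hsymm y hy).differentiableAt one_ne_zero)]
      rfl
    have h2 : T (G.symm y) (fderiv ℝ (F ∘ G.symm) y w) = D w := by
      rw [hTapp, hPφ y hy, h1, hNz, zero_smul, add_zero]
    rw [ContinuousLinearMap.comp_apply, ← h2, hSz]
  refine ⟨G, ⟨he, hxA⟩, fun z hz => (hA z hz.2).1, ?_, fun y hy => ?_⟩
  · rw [show (2 : WithTop ℕ∞) = 1 + 1 by norm_num, contDiffOn_succ_iff_fderiv_of_isOpen G.open_target]
    refine ⟨fun y hy => ((hφ y hy).differentiableAt one_ne_zero).differentiableWithinAt,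
      by simp, ContDiffOn.congr (fun y hy => ContDiffAt.contDiffWithinAt ?_) hfd⟩
    exact ((hA _ (hGt y hy)).2.2.1.comp y (hsymm y hy)).clm_comp contDiffAt_const
  · exact Function.LeftInverse.injective (hPφ y hy)

/-- The Gauss equation in an arbitrary parametrisation `φ = F ∘ τ` of class `C²`, in terms of the
derivative of a normal field. -/
theorem exists_sum_riemannTensor_eq {N : Coord n → Ambient n}
    (hF : ∀ᶠ x in 𝓝 x₀, ContDiffAt ℝ 1 F x)
    (hinj : ∀ᶠ x in 𝓝 x₀, Function.Injective (fderiv ℝ F x))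
    (hN : DifferentiableAt ℝ N x₀) (hN0 : N x₀ ≠ 0)
    (h : ∀ᶠ y in 𝓝 x₀, ∀ z, inner ℝ (N y) (fderiv ℝ F y z) = 0)
    {φ : Coord n → Ambient n} {τ : Coord n → Coord n} {U : Set (Coord n)} {y₀ : Coord n}
    (hU : IsOpen U) (hφ : ContDiffOn ℝ 2 φ U) (hy₀ : y₀ ∈ U)
    (hφinj : Function.Injective (fderiv ℝ φ y₀)) (hτ₀ : τ y₀ = x₀)
    (hτ : ∀ᶠ y in 𝓝 y₀, ContinuousAt τ y) (hφτ : ∀ᶠ y in 𝓝 y₀, φ y = F (τ y))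
    {X Y : Coord n} (hXY : inner ℝ (fderiv ℝ N x₀ Y) (fderiv ℝ F x₀ X) = 0) :
    ∃ a b : Coord n, fderiv ℝ φ y₀ a = fderiv ℝ F x₀ X ∧ fderiv ℝ φ y₀ b = fderiv ℝ F x₀ Y ∧
      ∑ i, ∑ j, ∑ k, ∑ l, riemannTensor φ i j k l y₀ * a i * b j * b k * a l =
        inner ℝ (fderiv ℝ N x₀ X) (fderiv ℝ F x₀ X) * inner ℝ (fderiv ℝ N x₀ Y) (fderiv ℝ F x₀ Y) /
          inner ℝ (N x₀) (N x₀) := by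
  have hτc : Tendsto τ (𝓝 y₀) (𝓝 x₀) := hτ₀ ▸ hτ.self_of_nhds
  have key : ∀ᶠ y in 𝓝 y₀, DifferentiableAt ℝ τ y ∧
      fderiv ℝ φ y = (fderiv ℝ F (τ y)).comp (fderiv ℝ τ y) := by
    filter_upwards [hτc.eventually hF, hτc.eventually hinj, hτ, hφτ.eventually_nhds,
      hU.mem_nhds hy₀] with y h1 h2 h3 h4 h5
    have hd := differentiableAt_of_comp_immersion h1 h2
      ((hφ.contDiffAt (hU.mem_nhds h5)).differentiableAt two_ne_zero) h3 rfl h4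
    refine ⟨hd, ?_⟩
    rw [EventuallyEq.fderiv_eq (f := fun y => F (τ y)) h4]
    exact fderiv_comp y (h1.differentiableAt one_ne_zero) hd
  obtain ⟨hτd, hφd⟩ := key.self_of_nhds
  rw [hτ₀] at hφd
  have hτinj : Function.Injective (fderiv ℝ τ y₀) := by
    refine Function.Injective.of_comp (f := fderiv ℝ F x₀) ?_
    rw [hφd] at hφinj
    exact hφinj
  have hτsurj : Function.Surjective (fderiv ℝ τ y₀) :=
    LinearMap.injective_iff_surjective.1 hτinj
  obtain ⟨a, ha⟩ := hτsurj X
  obtain ⟨b, hb⟩ := hτsurj Y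
  have hφa : fderiv ℝ φ y₀ a = fderiv ℝ F x₀ X := by
    rw [hφd, ContinuousLinearMap.comp_apply, ha]
  have hφb : fderiv ℝ φ y₀ b = fderiv ℝ F x₀ Y := by
    rw [hφd, ContinuousLinearMap.comp_apply, hb]
  have hNτ : DifferentiableAt ℝ (fun y => N (τ y)) y₀ :=
    DifferentiableAt.comp y₀ (by rwa [hτ₀]) hτd
  have hNd : ∀ v, fderiv ℝ (fun y => N (τ y)) y₀ v = fderiv ℝ N x₀ (fderiv ℝ τ y₀ v) := by
    intro v
    have := fderiv_comp y₀ (g := N) (f := τ) (by rwa [hτ₀]) hτd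
    rw [hτ₀] at this
    exact DFunLike.congr_fun this v
  have horth : ∀ᶠ y in 𝓝 y₀, ∀ z, inner ℝ (N (τ y)) (fderiv ℝ φ y z) = 0 := by
    filter_upwards [key, hτc.eventually h] with y h1 h2 z
    rw [h1.2]
    exact h2 _
  have hII := inner_fderiv_fderiv_eq_neg (hφ.contDiffAt (hU.mem_nhds hy₀)) hNτ horth
  refine ⟨a, b, hφa, hφb, ?_⟩
  -- The two mixed entries enter as a product, so `hXY` in one order suffices.
  rw [sum_riemannTensor hU hφ hy₀ hφinj (N := N (τ y₀)) (by rwa [hτ₀]) horth.self_of_nhds]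
  simp only [hII, hNd, ha, hb, hφa, hφb, hXY]
  rw [hτ₀]
  ring

/-! ### The focal sheet in coordinates -/

/-- The focal sheet of a principal curvature has a normal field of class `C¹`, and this determines
its second fundamental form. -/
theorem exists_focal_normal {ι ν : Coord n → Ambient n} {ρ σ : Coord n → ℝ}
    {X Y : Coord n → Coord n}
    (hι : ∀ᶠ y in 𝓝 x₀, ContDiffAt ℝ 2 ι y) (hν : ∀ᶠ y in 𝓝 x₀, ContDiffAt ℝ 2 ν y)
    (hρ : ∀ᶠ y in 𝓝 x₀, ContDiffAt ℝ 1 ρ y) (hσ : ContDiffAt ℝ 1 σ x₀)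
    (hinj : Function.Injective (fderiv ℝ ι x₀))
    (horth : ∀ᶠ y in 𝓝 x₀, ∀ z, inner ℝ (ν y) (fderiv ℝ ι y z) = 0)
    (hnorm : ∀ᶠ y in 𝓝 x₀, ‖ν y‖ = 1)
    (hX : ∀ᶠ y in 𝓝 x₀, ρ y • fderiv ℝ ν y (X y) = fderiv ℝ ι y (X y) ∧ fderiv ℝ ρ y (X y) = 1)
    (hY : ∀ᶠ y in 𝓝 x₀, σ y • fderiv ℝ ν y (Y y) = fderiv ℝ ι y (Y y) ∧ fderiv ℝ σ y (Y y) = 1)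
    (hXsimple : ∀ z, ρ x₀ • fderiv ℝ ν x₀ z = fderiv ℝ ι x₀ z → ∃ c : ℝ, z = c • X x₀)
    (hYsimple : ∀ z, σ x₀ • fderiv ℝ ν x₀ z = fderiv ℝ ι x₀ z → ∃ c : ℝ, z = c • Y x₀)
    (hne : ρ x₀ ≠ σ x₀) {f : Coord n → Ambient n} (hf : f = fun y => ι y - ρ y • ν y) :
    ∃ N : Coord n → Ambient n, ContDiffAt ℝ 1 N x₀ ∧ N x₀ ≠ 0 ∧
      (∀ᶠ y in 𝓝 x₀, ∀ z, inner ℝ (N y) (fderiv ℝ f y z) = 0) ∧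
      inner ℝ (fderiv ℝ N x₀ (Y x₀)) (fderiv ℝ f x₀ (X x₀)) = 0 ∧
      LinearIndependent ℝ ![fderiv ℝ f x₀ (X x₀), fderiv ℝ f x₀ (Y x₀)] ∧
      (fderiv ℝ (fun y => ρ y - σ y) x₀ (X x₀) - 1) / (ρ x₀ - σ x₀) ^ 2 =
        inner ℝ (fderiv ℝ N x₀ (X x₀)) (fderiv ℝ f x₀ (X x₀)) *
          inner ℝ (fderiv ℝ N x₀ (Y x₀)) (fderiv ℝ f x₀ (Y x₀)) / inner ℝ (N x₀) (N x₀) /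
          (inner ℝ (fderiv ℝ f x₀ (X x₀)) (fderiv ℝ f x₀ (X x₀)) *
            inner ℝ (fderiv ℝ f x₀ (Y x₀)) (fderiv ℝ f x₀ (Y x₀)) -
            inner ℝ (fderiv ℝ f x₀ (X x₀)) (fderiv ℝ f x₀ (Y x₀)) ^ 2) := by
  have ne0 : ∀ {θ : Coord n → ℝ} {y v : Coord n}, fderiv ℝ θ y v = 1 → v ≠ 0 := by
    rintro θ y v hv rfl
    rw [map_zero] at hv
    exact zero_ne_one hv
  have hι0 := hι.self_of_nhds
  have hν0 := hν.self_of_nhds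
  obtain ⟨Z, hZ, hZ0, hρZ⟩ := exists_principal_field hι0 hν0 hρ.self_of_nhds hinj horth hnorm
    (hX.mono fun y hy => ⟨hy.1, ne0 hy.2⟩) hXsimple
  obtain ⟨W, hW, hW0, hσW⟩ := exists_principal_field hι0 hν0 hσ hinj horth hnorm
    (hY.mono fun y hy => ⟨hy.1, ne0 hy.2⟩) hYsimple
  -- `Z` agrees with `X` only at `x₀`. This is enough: near `x₀` only the eigenvector equation is
  -- needed, and the normalisation only at `x₀`.
  obtain ⟨N, hN⟩ : ∃ N : Coord n → Ambient n, N = fun y => fderiv ℝ ι y (Z y) := ⟨_, rfl⟩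
  have hcurv := focal_curvature hι0 hν0 (hρ.self_of_nhds.differentiableAt one_ne_zero)
    (hσ.differentiableAt one_ne_zero) hinj horth hnorm (hZ.differentiableAt one_ne_zero)
    (hW.differentiableAt one_ne_zero) hρZ hσW hne (by rw [hZ0]; exact hX.self_of_nhds.2)
    (by rw [hW0]; exact hY.self_of_nhds.2) hf hN
  rw [hZ0, hW0] at hcurv
  refine ⟨N, hN ▸ (hι0.fderiv_right le_rfl).clm_apply hZ, ?_, ?_, hcurv⟩
  · rw [hN]
    change fderiv ℝ ι x₀ (Z x₀) ≠ 0
    rw [hZ0]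
    exact fun h0 => ne0 hX.self_of_nhds.2 (hinj (by rw [h0, map_zero]))
  · filter_upwards [hι, hν, hρ, horth.eventually_nhds, hρZ] with y h1 h2 h3 h4 h5 z
    rw [hf, hN]
    exact inner_fderiv_focalMap h1 (h2.differentiableAt two_ne_zero)
      (h3.differentiableAt one_ne_zero) h4 h5 z

/-- For a left inverse `L` of `D`, the operator `L ∘ B` has the `n` distinct eigenvalues `1 / r k`
on an `n`-dimensional space, so its eigenspaces are lines. -/
theorem exists_eq_smul_of_simple {n : ℕ} {D B : Coord n →L[ℝ] Ambient n}
    (hD : Function.Injective D) {r : Fin n → ℝ} (hr : Function.Injective r)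
    (heig : ∀ k, ∃ Z, Z ≠ 0 ∧ r k • B Z = D Z) {i : Fin n} {X z : Coord n} (hX0 : X ≠ 0)
    (hX : r i • B X = D X) (hz : r i • B z = D z) : ∃ c : ℝ, z = c • X := by
  obtain ⟨v, hvi, hv⟩ : ∃ v : Fin n → Coord n, v i = X ∧ ∀ k, v k ≠ 0 ∧ r k • B (v k) = D (v k) := by
    choose Z hZ using heig
    refine ⟨Function.update Z i X, Function.update_self .., fun k => ?_⟩
    by_cases hk : k = i
    · subst hk
      rw [Function.update_self]
      exact ⟨hX0, hX⟩
    · rw [Function.update_of_ne hk]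
      exact hZ k
  obtain ⟨L, hL⟩ := D.toLinearMap.exists_leftInverse_of_injective (LinearMap.ker_eq_bot.2 hD)
  have hL' : ∀ w, L (D w) = w := fun w => LinearMap.congr_fun hL w
  have hr0 : ∀ k, r k ≠ 0 := fun k h => (hv k).1 (hD (by rw [← (hv k).2, h, zero_smul, map_zero]))
  let S : Module.End ℝ (Coord n) := L.comp B.toLinearMap
  have hS : ∀ k w, r k • B w = D w → S w = (r k)⁻¹ • w := by
    intro k w hw
    rw [eq_inv_smul_iff₀ (hr0 k)]
    change r k • L (B w) = w
    rw [← map_smul, hw, hL']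
  have hli : LinearIndependent ℝ v :=
    Module.End.eigenvectors_linearIndependent' S (fun k => (r k)⁻¹)
      (inv_injective.comp hr) v fun k =>
        ⟨Module.End.mem_eigenspace_iff.2 (hS k _ (hv k).2), (hv k).1⟩
  have : Nonempty (Fin n) := ⟨i⟩
  let b := basisOfLinearIndependentOfCardEqFinrank
    hli (by simp)
  have hb : ∀ k, b k = v k := fun k => by simp [b]
  have hzsum : ∑ k, b.repr z k • v k = z := by
    simp_rw [← hb]
    exact b.sum_repr z
  have h0 : ∑ k, (b.repr z k * ((r k)⁻¹ - (r i)⁻¹)) • v k = 0 := by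
    have h1 : S z = ∑ k, (b.repr z k * (r k)⁻¹) • v k := by
      conv_lhs => rw [← hzsum]
      rw [map_sum]
      exact Finset.sum_congr rfl fun k _ => by rw [map_smul, hS k _ (hv k).2, smul_smul]
    have h2 : S z = ∑ k, (b.repr z k * (r i)⁻¹) • v k := by
      rw [hS i z hz]
      conv_lhs => rw [← hzsum]
      rw [Finset.smul_sum]
      exact Finset.sum_congr rfl fun k _ => by rw [smul_smul, mul_comm]
    simp_rw [mul_sub, sub_smul]
    rw [Finset.sum_sub_distrib, ← h1, ← h2, sub_self]
  have hc := Fintype.linearIndependent_iff.1 hli _ h0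
  refine ⟨b.repr z i, ?_⟩
  rw [← hvi]
  conv_lhs => rw [← hzsum]
  refine Finset.sum_eq_single i (fun k _ hk => ?_) (by simp)
  have hne : (r k)⁻¹ - (r i)⁻¹ ≠ 0 := sub_ne_zero.2 fun h => hk (hr (inv_injective h))
  rw [(mul_eq_zero.1 (hc k)).resolve_right hne, zero_smul]

/-! ### Differentials in charts -/

section Chart

variable {n : ℕ} {M : Type*} [TopologicalSpace M] [ChartedSpace (Coord n) M]
  {V : Type*} [NormedAddCommGroup V] [NormedSpace ℝ V]

theorem contDiffOn_comp_chart_symm {k : ℕ∞ω} [IsManifold (𝓡 n) k M] {f : M → V}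
    (hf : ContMDiff (𝓡 n) 𝓘(ℝ, V) k f) (q : M) :
    ContDiffOn ℝ k (f ∘ (chartAt (Coord n) q).symm) (chartAt (Coord n) q).target :=
  contMDiffOn_iff_contDiffOn.1 (hf.comp_contMDiffOn contMDiffOn_chart_symm)

theorem diff_eq_fderiv_chart [IsManifold (𝓡 n) 1 M] {f : M → V}
    (hf : ContMDiff (𝓡 n) 𝓘(ℝ, V) 1 f) {p q : M} (hp : p ∈ (chartAt (Coord n) q).source)
    (Z : TangentSpace (𝓡 n) p) :
    diff f p Z = fderiv ℝ (f ∘ (chartAt (Coord n) q).symm) (chartAt (Coord n) q p)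
      (mfderiv (𝓡 n) 𝓘(ℝ, Coord n) (extChartAt (𝓡 n) q) p Z) := by
  set c := chartAt (Coord n) q
  have h1 : f =ᶠ[𝓝 p] (f ∘ c.symm) ∘ (extChartAt (𝓡 n) q) := by
    filter_upwards [c.open_source.mem_nhds hp] with y hy
    exact congrArg f (c.left_inv hy).symm
  have h2 : DifferentiableAt ℝ (f ∘ c.symm) (c p) :=
    ((contDiffOn_comp_chart_symm hf q).contDiffAt
      (c.open_target.mem_nhds (c.map_source hp))).differentiableAt one_ne_zero
  have h3 := ((h2.hasFDerivAt.hasMFDerivAt).comp (I' := 𝓘(ℝ, Coord n)) p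
    (mdifferentiableAt_extChartAt (I := 𝓡 n) hp).hasMFDerivAt).congr_of_eventuallyEq h1
  exact DFunLike.congr_fun h3.mfderiv Z

end Chart

end FocalSheet

/-! ### Transfer to the hypersurface -/

theorem theorem2 {n : ℕ} {M : Type*} [TopologicalSpace M]
    [ChartedSpace (FocalSheet.Coord n) M] [IsManifold (𝓡 n) 3 M]
    (ι ν : M → FocalSheet.Ambient n)
    (hι : FocalSheet.IsC3Hypersurface ι)
    (hν : FocalSheet.IsUnitNormal ι ν)
    (hconv : FocalSheet.IsStrictlyConvex ι ν)
    (r : Fin n → M → ℝ)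
    (hr : FocalSheet.AreSimpleRadii ι ν r)
    (i j : Fin n) (hij : i ≠ j)
    (hYi : FocalSheet.IsDiffeoOntoImage (FocalSheet.focalMap ι ν (r i)))
    (hYj : FocalSheet.IsDiffeoOntoImage (FocalSheet.focalMap ι ν (r j)))
    (Xi Xj : (q : M) → TangentSpace (𝓡 n) q)
    (hXi : FocalSheet.IsNormalisedPrincipalField ι ν (r i) Xi)
    (hXj : FocalSheet.IsNormalisedPrincipalField ι ν (r j) Xj)
    (q : M) :
    FocalSheet.HasSectionalCurvatureAt (FocalSheet.focalMap ι ν (r i)) q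
      (FocalSheet.diff (FocalSheet.focalMap ι ν (r i)) q (Xi q))
      (FocalSheet.diff (FocalSheet.focalMap ι ν (r i)) q (Xj q))
      ((FocalSheet.diff (fun p => r i p - r j p) q (Xi q) - 1) / (r i q - r j q) ^ 2) := by
  open FocalSheet in
  have : IsManifold (𝓡 n) 2 M := IsManifold.of_le (n := 3) (by norm_cast)
  have : IsManifold (𝓡 n) 1 M := IsManifold.of_le (n := 3) (by norm_cast)
  have hι2 := hι.contMDiff.of_le (show (2 : ℕ∞ω) ≤ 3 by norm_cast)
  have hι1 := hι.contMDiff.of_le (show (1 : ℕ∞ω) ≤ 3 by norm_cast)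
  have hν1 := hν.contMDiff.of_le (show (1 : ℕ∞ω) ≤ 2 by norm_cast)
  -- Regularity of the radii comes from that of the focal maps, through `r_k = ⟨ν, ι - Y_k⟩`.
  have hr1 : ∀ k, IsDiffeoOntoImage (focalMap ι ν (r k)) →
      ContMDiff (𝓡 n) 𝓘(ℝ, ℝ) 1 (r k) := by
    intro k hk
    have h1 : r k = fun p => inner ℝ (ν p) (ι p - focalMap ι ν (r k) p) := by
      ext p
      rw [focalMap, sub_sub_cancel, inner_smul_right, real_inner_self_eq_norm_sq, hν.norm_eq_one]
      ring
    rw [h1]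
    exact (contDiff_inner (𝕜 := ℝ) (E := Ambient n) (n := 1)).contMDiff.comp
      (hν1.prodMk_space (hι1.sub hk.contMDiff))
  have hri := hr1 i hYi
  have hrj := hr1 j hYj
  set c := chartAt (Coord n) q with hc
  have hq : q ∈ c.source := mem_chart_source _ q
  have hct : c.target ∈ 𝓝 (c q) := c.open_target.mem_nhds (c.map_source hq)
  let e : (p : M) → TangentSpace (𝓡 n) p → Coord n := fun p =>
    mfderiv (𝓡 n) 𝓘(ℝ, Coord n) (extChartAt (𝓡 n) q) p
  have he : ∀ p ∈ c.source, Function.Bijective (e p) := by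
    intro p hp
    obtain ⟨L, hL⟩ := isInvertible_mfderiv_extChartAt (I := 𝓡 n) (x := q) (y := p)
      (by rwa [extChartAt_source])
    change Function.Bijective (mfderiv (𝓡 n) 𝓘(ℝ, Coord n) (extChartAt (𝓡 n) q) p)
    rw [← hL]
    exact L.bijective
  have hsymm : ∀ x ∈ c.target, c.symm x ∈ c.source ∧ c (c.symm x) = x := fun x hx =>
    ⟨c.map_target hx, c.right_inv hx⟩
  have hat : ∀ {V : Type} [NormedAddCommGroup V] [NormedSpace ℝ V] {k : ℕ∞ω} [IsManifold (𝓡 n) k M]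
      {f : M → V}, ContMDiff (𝓡 n) 𝓘(ℝ, V) k f → ∀ x ∈ c.target, ContDiffAt ℝ k (f ∘ c.symm) x :=
    fun hf x hx => (contDiffOn_comp_chart_symm hf q).contDiffAt (c.open_target.mem_nhds hx)
  have hd : ∀ {V : Type} [NormedAddCommGroup V] [NormedSpace ℝ V] {f : M → V},
      ContMDiff (𝓡 n) 𝓘(ℝ, V) 1 f → ∀ x ∈ c.target, ∀ Z : TangentSpace (𝓡 n) (c.symm x),
      diff f (c.symm x) Z = fderiv ℝ (f ∘ c.symm) x (e (c.symm x) Z) := by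
    intro V _ _ f hf x hx Z
    have := diff_eq_fderiv_chart hf (hsymm x hx).1 Z
    rw [← hc, (hsymm x hx).2] at this
    exact this
  have hinj : ∀ {f : M → Ambient n}, ContMDiff (𝓡 n) 𝓘(ℝ, Ambient n) 1 f →
      (∀ p, Function.Injective (diff (n := n) f p)) →
      ∀ x ∈ c.target, Function.Injective (fderiv ℝ (f ∘ c.symm) x) := by
    intro f hf hfinj x hx
    have := hfinj (c.symm x)
    rw [show ⇑(diff f (c.symm x)) = fderiv ℝ (f ∘ c.symm) x ∘ e (c.symm x) from
      funext (hd hf x hx)] at this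
    exact (Function.Injective.of_comp_iff' _ (he _ (hsymm x hx).1)).1 this
  have hX : ∀ {ρ : M → ℝ} {X : (q : M) → TangentSpace (𝓡 n) q}, ContMDiff (𝓡 n) 𝓘(ℝ, ℝ) 1 ρ →
      IsNormalisedPrincipalField ι ν ρ X → ∀ x ∈ c.target,
      (ρ ∘ c.symm) x • fderiv ℝ (ν ∘ c.symm) x (e _ (X (c.symm x))) =
        fderiv ℝ (ι ∘ c.symm) x (e _ (X (c.symm x))) ∧
        fderiv ℝ (ρ ∘ c.symm) x (e _ (X (c.symm x))) = 1 := by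
    intro ρ X hρ hX x hx
    rw [← hd hν1 x hx, ← hd hι1 x hx, ← hd hρ x hx]
    exact ⟨hX.principal _, hX.normalised _⟩
  have hcq : c.symm (c q) = q := c.left_inv hq
  have hx₀ : c q ∈ c.target := c.map_source hq
  let X : Coord n → Coord n := fun x => e _ (Xi (c.symm x))
  let Y : Coord n → Coord n := fun x => e _ (Xj (c.symm x))
  have hX₀ : X (c q) = e q (Xi q) := congrArg (fun p => e p (Xi p)) hcq
  have hY₀ : Y (c q) = e q (Xj q) := congrArg (fun p => e p (Xj p)) hcq
  have hsimple : ∀ (k : Fin n) {z w : Coord n}, w ≠ 0 →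
      (r k ∘ c.symm) (c q) • fderiv ℝ (ν ∘ c.symm) (c q) w = fderiv ℝ (ι ∘ c.symm) (c q) w →
      (r k ∘ c.symm) (c q) • fderiv ℝ (ν ∘ c.symm) (c q) z = fderiv ℝ (ι ∘ c.symm) (c q) z →
      ∃ a : ℝ, z = a • w := by
    intro k z w hw0 hw hz
    refine exists_eq_smul_of_simple (hinj hι1 hι.injective_diff _ hx₀)
      (r := fun k => (r k ∘ c.symm) (c q)) (hr.simple (c.symm (c q))) (fun l => ?_) hw0 hw hz
    obtain ⟨Z, hZ0, hZ⟩ := hr.eigen l (c.symm (c q))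
    rw [hd hν1 _ hx₀, hd hι1 _ hx₀] at hZ
    refine ⟨e _ Z, fun h => hZ0 ((he _ (hsymm _ hx₀).1).1 (h.trans ?_)), hZ⟩
    exact (map_zero (mfderiv (𝓡 n) 𝓘(ℝ, Coord n) (extChartAt (𝓡 n) q) (c.symm (c q)))).symm
  have ne0 : ∀ {θ : Coord n → ℝ} {y v : Coord n}, fderiv ℝ θ y v = 1 → v ≠ 0 := by
    rintro θ y v hv rfl
    rw [map_zero] at hv
    exact zero_ne_one hv
  have hXc := hX hri hXi
  have hYc := hX hrj hXj
  have hrc : ∀ k, (r k ∘ c.symm) (c q) = r k q := fun k => congrArg (r k) hcq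
  obtain ⟨N, hN, hN0, hNorth, hNXY, hli, hK⟩ := exists_focal_normal (x₀ := c q) (X := X) (Y := Y)
    (mem_of_superset hct (hat hι2)) (mem_of_superset hct (hat hν.contMDiff))
    (mem_of_superset hct (hat hri)) (hat hrj _ hx₀) (hinj hι1 hι.injective_diff _ hx₀)
    (by
      filter_upwards [hct] with x hx z
      obtain ⟨Z, rfl⟩ := (he _ (hsymm x hx).1).2 z
      rw [← hd hι1 x hx]
      exact hν.orthogonal _ _)
    (Eventually.of_forall fun x => hν.norm_eq_one _)
    (mem_of_superset hct hXc) (mem_of_superset hct hYc)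
    (fun z => hsimple i (ne0 (hXc _ hx₀).2) (hXc _ hx₀).1)
    (fun z => hsimple j (ne0 (hYc _ hx₀).2) (hYc _ hx₀).1)
    (by rw [hrc, hrc]; exact fun h => hij (hr.simple q h))
    (f := focalMap ι ν (r i) ∘ c.symm) rfl
  set f := focalMap ι ν (r i) with hf
  have hf1 := hYi.contMDiff
  have hdq : ∀ {V : Type} [NormedAddCommGroup V] [NormedSpace ℝ V] {g : M → V},
      ContMDiff (𝓡 n) 𝓘(ℝ, V) 1 g → ∀ Z : TangentSpace (𝓡 n) q,
      diff g q Z = fderiv ℝ (g ∘ c.symm) (c q) (e q Z) := fun hg Z =>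
    diff_eq_fderiv_chart hg hq Z
  have hKq : diff (fun p => r i p - r j p) q (Xi q) =
      fderiv ℝ (fun y => (r i ∘ c.symm) y - (r j ∘ c.symm) y) (c q) (X (c q)) := by
    rw [hdq (hri.sub hrj), hX₀]
    rfl
  rw [hdq hf1, hdq hf1, hKq, ← hX₀, ← hY₀, ← hrc, ← hrc, hK]
  have hFat := hat hf1
  have hFinj := hinj hf1 hYi.injective_diff
  refine ⟨hli, ?_, fun ψ hψ hqψ => ?_⟩
  -- The `C²` parametrisation is the inverse chart precomposed with the straightening; `G.source ⊆
  -- c.target` ensures that its source is all of `G.target`.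
  · obtain ⟨G, hG, hGc, hG2, hGinj⟩ := exists_contDiffOn_two_reparametrisation (hFat _ hx₀)
      (hFinj _ hx₀) hN hN0 hNorth hct
    have hsource : (G.symm.trans c.symm).source = G.target :=
      Set.inter_eq_left.2 fun y hy => hGc (G.map_target hy)
    refine ⟨G.symm.trans c.symm, ⟨?_, ?_⟩, ?_⟩
    · rw [hsource]
      exact hG2
    · rw [hsource]
      exact hGinj
    · have h1 : G (c q) ∈ (G.symm.trans c.symm).source := by
        rw [hsource]
        exact G.map_source hG
      have h2 : (G.symm.trans c.symm) (G (c q)) = q := by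
        change c.symm (G.symm (G (c q))) = q
        rw [G.left_inv hG, hcq]
      exact h2 ▸ (G.symm.trans c.symm).map_source h1
  · have hψq : ψ.symm q ∈ ψ.source := ψ.map_target hqψ
    have hψψ : ψ (ψ.symm q) = q := ψ.right_inv hqψ
    have hev : ∀ᶠ y in 𝓝 (ψ.symm q), y ∈ ψ.source ∧ ψ y ∈ c.source := by
      refine Eventually.and (ψ.open_source.mem_nhds hψq) ?_
      refine (ψ.continuousAt hψq).eventually (c.open_source.mem_nhds ?_)
      rwa [hψψ]
    -- `ψ` carries only the topology of `M`, so the transition `c ∘ ψ` is a priori merely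
    -- continuous.
    obtain ⟨a, b, ha, hb, hab⟩ := exists_sum_riemannTensor_eq (F := f ∘ c.symm) (x₀ := c q)
      (mem_of_superset hct hFat) (mem_of_superset hct hFinj) (hN.differentiableAt one_ne_zero) hN0
      hNorth (φ := f ∘ ψ) (τ := c ∘ ψ) ψ.open_source hψ.contDiffOn hψq
      (hψ.injective_fderiv _ hψq) (congrArg c hψψ)
      (hev.mono fun y hy => (c.continuousAt hy.2).comp (ψ.continuousAt hy.1))
      (hev.mono fun y hy => congrArg f (c.left_inv hy.2).symm) hNXY
    exact ⟨riemannTensor (f ∘ ψ), isRiemannTensorOn_riemannTensor ψ.open_source hψ.contDiffOn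
      hψ.injective_fderiv, a, b, ha, hb, by rw [hab]⟩
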